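/- Let $\mathcal N$ be a von Neumann algebra on a Hilbert space. A $W^*$-correspondence over $\mathcal N$ is a self-dual right Hilbert $C^*$-module $E$ over $\mathcal N$ (with inner product $\langle\cdot,\cdot\rangle\in\mathcal N$ linear in the second variable) together with a normal $*$-homomorphism from $\mathcal N$ into the adjointable operators on $E$, written as a left action. Its $\sigma$-topology is the one defined by the functionals $\sum_n w_n(\langle\eta_n,\cdot\rangle)$ with $w_n\in\mathcal N_*$, $\eta_n\in E$, $\sum_n\|w_n\|\|\eta_n\|<\infty$. The tensor product $E\otimes F$ of correspondences is the (self-dual) completion of the algebraic tensor product for $\langle\xi_1\otimes\eta_1,\xi_2\otimes\eta_2\rangle=\langle\eta_1,\langle\xi_1,\xi_2\rangle\eta_2\rangle$. A discrete product system over $\mathcal N$ is a family $\{E(t)\}_{t\ge 0}$ of $W^*$-correspondences over $\mathcal N$ with $E(0)=\mathcal N$ and with isomorphisms $E(t)\otimes E(s)\simeq E(t+s)$, $t,s\ge 0$, of correspondences that are associative and that for $t=0$, respectively $s=0$, are given by the left, respectively right, action of $\mathcal N$. A covariant representation of it on a Hilbert space $H$ is a family $\{T_t\}_{t\ge0}$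 of completely contractive linear maps $T_t:E(t)\to\mathcal B(H)$, continuous from the $\sigma$-topology to the $\sigma$-weak topology, such that $T_0$ is a $*$-representation of $\mathcal N$ and $T_{t+s}(\xi\otimes\eta)=T_t(\xi)T_s(\eta)$ for $\xi\in E(t)$, $\eta\in E(s)$, $t,s\ge0$. It is isometric if $T_t(\xi)^*T_t(\eta)=T_0(\langle\xi,\eta\rangle)$ for all $t\ge0$ and $\xi,\eta\in E(t)$. It is fully coisometric if $\widetilde T_t\widetilde T_t^*=I_H$ for all $t\ge 0$, where $\widetilde T_t:E(t)\otimes_{T_0}H\to H$ is the bounded operator with $\widetilde T_t(\xi\otimes h)=T_t(\xi)h$ and $E(t)\otimes_{T_0}H$ is the Hausdorff completion of the algebraic tensor product for $\langle\xi\otimes h,\eta\otimes k\rangle=\langle h,T_0(\langle\xi,\eta\rangle)k\rangle$. **Theorem.** Let $\{E(t)\}_{t\ge0}$ be a discrete product system over $\mathcal N$ and let $\{T_t\}_{t\ge0}$ be a fully coisometric covariant representation of it on a Hilbert space $H$. Then there are a Hilbert space $K$, an isometry $u_0:H\to K$ and a fully coisometric, isometric covariant representation $\{V_t\}_{t\ge0}$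 of $\{E(t)\}_{t\ge0}$ on $K$ such that 1. $u_0^*V_t(\xi)u_0=T_t(\xi)$ for all $\xi\in E(t)$, $t\ge0$; 2. $V_t(\xi)^*$ leaves $u_0(H)$ invariant for all $\xi\in E(t)$, $t\ge0$; 3. the smallest closed subspace of $K$ that contains $u_0(H)$ and reduces $V_t(\xi)$ for all $\xi\in E(t)$, $t\ge0$, is $K$. If $(\{V_t'\}_{t\ge0},u_0',K')$ is another triple with these properties, then there is a Hilbert space isomorphism $W:K\to K'$ with $WV_t(\xi)W^{-1}=V_t'(\xi)$ for all $\xi\in E(t)$, $t\ge0$, and $Wu_0=u_0'$. The triple $(\{V_t\}_{t\ge0},u_0,K)$ is called the minimal isometric dilation of $\{T_t\}_{t\ge0}$. -/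

import Mathlib

universe u v w z

open scoped TensorProduct NNReal InnerProductSpace Topology

noncomputable section

namespace ProductSystems

/-! ### Von Neumann algebras as C⋆-algebras, and the σ-weak topology -/

section VonNeumann

variable {H₀ : Type w} [NormedAddCommGroup H₀] [InnerProductSpace ℂ H₀] [CompleteSpace H₀]

instance smulMemClass_vonNeumann :
    SMulMemClass (VonNeumannAlgebra H₀) ℂ (H₀ →L[ℂ] H₀) where
  smul_mem {N} c _ ha := N.toStarSubalgebra.smul_mem ha c

/-- A von Neumann algebra is norm closed; with this instance Mathlib makes `↥N` a C⋆-algebra. -/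
instance isClosed_vonNeumann (N : VonNeumannAlgebra H₀) : IsClosed (N : Set (H₀ →L[ℂ] H₀)) := by
  rw [← N.centralizer_centralizer]
  exact Set.isClosed_centralizer _

/-- The σ-weak topology of `B(H)`: the coarsest topology that makes all the functionals
`S ↦ ∑ₙ ⟨xₙ, S yₙ⟩`, with `(xₙ)` and `(yₙ)` square summable, continuous. -/
@[reducible] def sigmaWeak (H : Type v) [NormedAddCommGroup H] [InnerProductSpace ℂ H] :
    TopologicalSpace (H →L[ℂ] H) :=
  ⨅ (x : lp (fun _ : ℕ => H) 2) (y : lp (fun _ : ℕ => H) 2),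
    TopologicalSpace.induced (fun S : H →L[ℂ] H => ∑' n, ⟪x n, S (y n)⟫_ℂ) inferInstance

/-- The σ-weak topology of a von Neumann algebra. -/
@[reducible] def sigmaWeakOn (N : VonNeumannAlgebra H₀) : TopologicalSpace N :=
  TopologicalSpace.induced (fun a : N => (a : H₀ →L[ℂ] H₀)) (sigmaWeak H₀)

/-- The predual `N_*`: the σ-weakly continuous (normal) functionals, inside the Banach dual. -/
def predual (N : VonNeumannAlgebra H₀) : Set (StrongDual ℂ N) :=
  {f | Continuous[sigmaWeakOn N, inferInstance] f}

end VonNeumann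

/-! ### W⋆-correspondences -/

section Modules

variable {H₀ : Type w} [NormedAddCommGroup H₀] [InnerProductSpace ℂ H₀] [CompleteSpace H₀]

/-- A (right) Hilbert C⋆-module `E` over the von Neumann algebra `N`, with an `N`-valued inner
product that is linear in its second variable.  The right action of `a` on `ξ` is
`MulOpposite.op a • ξ`.  Completeness is the instance `CompleteSpace E`.  (Mathlib's `CStarModule`
is about an action written on the left, with `⟪x, a • y⟫ = a * ⟪x, y⟫`.) -/
class HilbertModule (N : VonNeumannAlgebra H₀) (E : Type u) [NormedAddCommGroup E]
    [NormedSpace ℂ E] [CompleteSpace E] [Module (↥N)ᵐᵒᵖ E] where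
  /-- the `N`-valued inner product -/
  ip : E → E → N
  ip_add_right : ∀ ξ η ζ, ip ξ (η + ζ) = ip ξ η + ip ξ ζ
  ip_smul_right : ∀ (c : ℂ) ξ η, ip ξ (c • η) = c • ip ξ η
  ip_act_right : ∀ ξ η (a : N), ip ξ (MulOpposite.op a • η) = ip ξ η * a
  star_ip : ∀ ξ η, star (ip ξ η) = ip η ξ
  /-- `⟨ξ, ξ⟩` is a positive element of `N` -/
  ip_self_nonneg : ∀ ξ, ∃ b : N, ip ξ ξ = star b * b
  norm_sq : ∀ ξ, ‖ξ‖ ^ 2 = ‖ip ξ ξ‖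

/-- The module inner product `⟨ξ, η⟩ ∈ N`. -/
abbrev ip (N : VonNeumannAlgebra H₀) {E : Type u} [NormedAddCommGroup E]
    [NormedSpace ℂ E] [CompleteSpace E] [Module (↥N)ᵐᵒᵖ E] [HilbertModule N E] (ξ η : E) : N :=
  HilbertModule.ip ξ η

/-- The `σ`-topology of a Hilbert module `E` over `N`: the coarsest topology that makes all the
functionals `∑ₙ wₙ(⟨ηₙ, ·⟩)`, with `wₙ ∈ N_*`, `ηₙ ∈ E` and `∑ₙ ‖wₙ‖ ‖ηₙ‖ < ∞`, continuous. -/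
@[reducible] def sigmaTopology (N : VonNeumannAlgebra H₀) (E : Type u) [NormedAddCommGroup E]
    [NormedSpace ℂ E] [CompleteSpace E] [Module (↥N)ᵐᵒᵖ E] [HilbertModule N E] :
    TopologicalSpace E :=
  ⨅ (f : ℕ → StrongDual ℂ N) (η : ℕ → E) (_ : ∀ n, f n ∈ predual N)
    (_ : Summable fun n => ‖f n‖ * ‖η n‖),
    TopologicalSpace.induced (fun ξ : E => ∑' n, f n (ip N (η n) ξ)) inferInstance

/-- A W⋆-correspondence over `N`: a self-dual Hilbert module `E` over `N` with a normal
`⋆`-homomorphism `left` from `N` to the adjointable operators of `E`. -/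
class WStarCorrespondence (N : VonNeumannAlgebra H₀) (E : Type u) [NormedAddCommGroup E]
    [NormedSpace ℂ E] [CompleteSpace E] [Module (↥N)ᵐᵒᵖ E] extends HilbertModule N E where
  /-- self-duality: bounded module maps from `E` to `N` are inner products with an element -/
  self_dual : ∀ Φ : E →L[ℂ] N, (∀ (ξ : E) (a : N), Φ (MulOpposite.op a • ξ) = Φ ξ * a) →
    ∃ ζ : E, ∀ ξ, Φ ξ = ip ζ ξ
  /-- the left action of `N` -/
  left : N →ₙₐ[ℂ] (E →L[ℂ] E)
  /-- `left a` is adjointable, with adjoint `left (star a)`; in particular it is a module map -/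
  left_adjoint : ∀ (a : N) (ξ η : E), ip (left a ξ) η = ip ξ (left (star a) η)
  /-- `left` is normal; the functionals `w(⟨ξ, · η⟩)`, with `w ∈ N_*` and `ξ, η ∈ E`, define the
  weak-⋆ topology on bounded sets of adjointable operators -/
  left_normal : ∀ ξ η : E,
    Continuous[sigmaWeakOn N, sigmaWeakOn N] fun a : N => ip ξ (left a η)

/-- The left action `a · ξ`. -/
abbrev lact (N : VonNeumannAlgebra H₀) {E : Type u} [NormedAddCommGroup E]
    [NormedSpace ℂ E] [CompleteSpace E] [Module (↥N)ᵐᵒᵖ E] [WStarCorrespondence N E]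
    (a : N) (ξ : E) : E :=
  WStarCorrespondence.left (N := N) (E := E) a ξ

/-- `m` induces an isomorphism of the tensor product `E ⊗_N F` of correspondences with the
correspondence `G`.  The tensor product is the self-dual completion of the algebraic tensor product
with the inner product `⟨ξ₁ ⊗ η₁, ξ₂ ⊗ η₂⟩ = ⟨η₁, ⟨ξ₁, ξ₂⟩ · η₂⟩`, so that an isomorphism onto the
self-dual `G` is a bimodule map on the algebraic tensor product that preserves inner products and
whose range is dense in the `σ`-topology.  (If the range is norm dense, then it is so.) -/
structure IsTensorIso (N : VonNeumannAlgebra H₀) {E F G : Type u}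
    [NormedAddCommGroup E] [NormedSpace ℂ E] [CompleteSpace E] [Module (↥N)ᵐᵒᵖ E]
    [WStarCorrespondence N E]
    [NormedAddCommGroup F] [NormedSpace ℂ F] [CompleteSpace F] [Module (↥N)ᵐᵒᵖ F]
    [WStarCorrespondence N F]
    [NormedAddCommGroup G] [NormedSpace ℂ G] [CompleteSpace G] [Module (↥N)ᵐᵒᵖ G]
    [WStarCorrespondence N G] (m : E →ₗ[ℂ] F →ₗ[ℂ] G) : Prop where
  ip_eq : ∀ ξ₁ η₁ ξ₂ η₂, ip N (m ξ₁ η₁) (m ξ₂ η₂) = ip N η₁ (lact N (ip N ξ₁ ξ₂) η₂)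
  left_eq : ∀ (a : N) ξ η, m (lact N a ξ) η = lact N a (m ξ η)
  right_eq : ∀ (a : N) ξ η, m ξ (MulOpposite.op a • η) = MulOpposite.op a • m ξ η
  dense : closure[sigmaTopology N G] ((TensorProduct.lift m).range : Set G) = Set.univ

/-- The data of a discrete product system on a family `E t`, `t ≥ 0`, of W⋆-correspondences over
`N`: isomorphisms `N ≃ E 0` and `E t ⊗ E s ≃ E (t + s)` of correspondences, such that the tensor
product is associative under these identifications and those with a factor `E 0 ≃ N` are the
left and the right action.  To avoid casts, `mul h ξ η` is in `E r` for `h : t + s = r`. -/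
structure DiscreteProductSystem (N : VonNeumannAlgebra H₀) (E : ℝ≥0 → Type u)
    [∀ t, NormedAddCommGroup (E t)] [∀ t, NormedSpace ℂ (E t)] [∀ t, CompleteSpace (E t)]
    [∀ t, Module (↥N)ᵐᵒᵖ (E t)] [∀ t, WStarCorrespondence N (E t)] where
  /-- the identification of `N` with `E 0` -/
  unit : N ≃ₗ[ℂ] E 0
  ip_unit : ∀ a b : N, ip N (unit a) (unit b) = star a * b
  left_unit : ∀ a b : N, lact N a (unit b) = unit (a * b)
  right_unit : ∀ a b : N, MulOpposite.op a • unit b = unit (b * a)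
  /-- the identification of `E t ⊗ E s` with `E (t + s)` -/
  mul : ∀ {t s r : ℝ≥0}, t + s = r → (E t →ₗ[ℂ] E s →ₗ[ℂ] E r)
  isTensorIso_mul : ∀ {t s r : ℝ≥0} (h : t + s = r), IsTensorIso N (mul h)
  unit_mul : ∀ {t : ℝ≥0} (a : N) (ξ : E t), mul (zero_add t) (unit a) ξ = lact N a ξ
  mul_unit : ∀ {t : ℝ≥0} (a : N) (ξ : E t), mul (add_zero t) ξ (unit a) = MulOpposite.op a • ξ
  mul_assoc : ∀ {t s r p q x : ℝ≥0} (h₁ : t + s = p) (h₂ : p + r = x) (h₃ : s + r = q)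
    (h₄ : t + q = x) (ξ : E t) (η : E s) (ζ : E r),
    mul h₂ (mul h₁ ξ η) ζ = mul h₄ ξ (mul h₃ η ζ)

end Modules

/-! ### The Hilbert space `E ⊗_σ H` -/

section Interior

theorem cstar_negPart_aux {B : Type*} [CStarAlgebra B] (M : B) (hsa : IsSelfAdjoint M) :
    ∃ x D : B, star x * M * x = -(star D * D) ∧ (D = 0 → ∃ C : B, M = star C * C) := by
  let _ : PartialOrder B := CStarAlgebra.spectralOrder B
  have _ : StarOrderedRing B := CStarAlgebra.spectralOrderedRing B
  have hn : 0 ≤ M⁻ := CFC.negPart_nonneg M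
  have hns : star M⁻ = M⁻ := hn.isSelfAdjoint
  obtain ⟨D, hD⟩ := CStarAlgebra.nonneg_iff_eq_star_mul_self.mp
    (show 0 ≤ M⁻ * M⁻ * M⁻ by
      have := star_left_conjugate_nonneg hn M⁻
      rwa [hns] at this)
  refine ⟨M⁻, D, ?_, fun hD0 => ?_⟩
  · rw [← hD, hns]
    have h := congrArg (fun z => M⁻ * z * M⁻) (CFC.posPart_sub_negPart M hsa)
    simp only [mul_sub, CFC.negPart_mul_posPart, zero_sub, neg_mul] at h
    exact h.symm
  · apply CStarAlgebra.nonneg_iff_eq_star_mul_self.mp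
    have h6 : M⁻ * M⁻ * M⁻ = 0 := by rw [hD, hD0]; simp
    have h7 : star (M⁻ * M⁻) * (M⁻ * M⁻) = 0 := by
      rw [star_mul, hns, ← mul_assoc, h6, zero_mul]
    have h8 : star M⁻ * M⁻ = 0 := by
      rw [hns]; exact (CStarRing.star_mul_self_eq_zero_iff _).mp h7
    have h9 : M⁻ = 0 := (CStarRing.star_mul_self_eq_zero_iff _).mp h8
    rw [← CFC.posPart_sub_negPart M hsa, h9, sub_zero]
    exact CFC.posPart_nonneg M

/-- A matrix `M` over a C⋆-algebra with `∑ᵢⱼ bᵢ⋆ Mᵢⱼ bⱼ ≥ 0` for all `b` is of the form `C⋆ C`. -/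
theorem cstar_exists_factor {A : Type*} [CStarAlgebra A] {n : ℕ} (M : Fin n → Fin n → A)
    (hsa : ∀ i j, star (M j i) = M i j)
    (hM : ∀ b : Fin n → A, ∃ c : A, ∑ i, ∑ j, star (b i) * M i j * b j = star c * c) :
    ∃ C : Fin n → Fin n → A, ∀ i j, M i j = ∑ k, star (C k i) * C k j := by
  let _ : PartialOrder A := CStarAlgebra.spectralOrder A
  have _ : StarOrderedRing A := CStarAlgebra.spectralOrderedRing A
  obtain ⟨x, D, h1, h2⟩ := cstar_negPart_aux (B := CStarMatrix (Fin n) (Fin n) A)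
    (CStarMatrix.ofMatrix M) (by ext i j; exact hsa i j)
  have h3 : ∀ k, ∑ l, star (D l k) * D l k = 0 := by
    intro k
    apply le_antisymm
    · obtain ⟨c, hc⟩ := hM (fun i => x i k)
      have h4 : (∑ i, ∑ j, star (x i k) * M i j * x j k) =
          (star x * CStarMatrix.ofMatrix M * x) k k := by
        rw [mul_assoc]
        simp only [CStarMatrix.mul_apply, Finset.mul_sum, ← mul_assoc]
        rfl
      have h5 : (-(star D * D)) k k = - ∑ l, star (D l k) * D l k := by
        simp [CStarMatrix.mul_apply, CStarMatrix.star_apply]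
      have h6 : 0 ≤ star c * c := star_mul_self_nonneg c
      rw [← hc, h4, h1, h5] at h6
      simpa using h6
    · exact Finset.sum_nonneg fun l _ => star_mul_self_nonneg _
  have hD0 : D = 0 := by
    ext l k
    have := (Finset.sum_eq_zero_iff_of_nonneg
      (fun l _ => star_mul_self_nonneg (D l k))).mp (h3 k) l (Finset.mem_univ l)
    simpa using (CStarRing.star_mul_self_eq_zero_iff _).mp this
  obtain ⟨C, hC⟩ := h2 hD0
  refine ⟨fun k j => C k j, fun i j => ?_⟩
  have : CStarMatrix.ofMatrix M i j = (star C * C) i j := by rw [hC]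
  rw [CStarMatrix.mul_apply] at this
  exact this

variable {H₀ : Type w} [NormedAddCommGroup H₀] [InnerProductSpace ℂ H₀] [CompleteSpace H₀]
  {N : VonNeumannAlgebra H₀}
  {H : Type v} [NormedAddCommGroup H] [InnerProductSpace ℂ H] [CompleteSpace H]

theorem ip_add_left {E : Type u} [NormedAddCommGroup E] [NormedSpace ℂ E] [CompleteSpace E]
    [Module (↥N)ᵐᵒᵖ E] [HilbertModule N E] (ξ η ζ : E) :
    ip N (ξ + η) ζ = ip N ξ ζ + ip N η ζ := by
  simp only [ip]
  rw [← HilbertModule.star_ip, HilbertModule.ip_add_right, star_add, HilbertModule.star_ip,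
    HilbertModule.star_ip]

theorem ip_smul_left {E : Type u} [NormedAddCommGroup E] [NormedSpace ℂ E] [CompleteSpace E]
    [Module (↥N)ᵐᵒᵖ E] [HilbertModule N E] (c : ℂ) (ξ ζ : E) :
    ip N (c • ξ) ζ = star c • ip N ξ ζ := by
  simp only [ip]
  rw [← HilbertModule.star_ip, HilbertModule.ip_smul_right, star_smul, HilbertModule.star_ip]

theorem ip_sum_right {E : Type u} [NormedAddCommGroup E] [NormedSpace ℂ E] [CompleteSpace E]
    [Module (↥N)ᵐᵒᵖ E] [HilbertModule N E] {n : ℕ} (ξ : E) (η : Fin n → E) :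
    ip N ξ (∑ i, η i) = ∑ i, ip N ξ (η i) :=
  map_sum (AddMonoidHom.mk' (fun η => ip N ξ η) (HilbertModule.ip_add_right ξ)) η _

theorem ip_sum_left {E : Type u} [NormedAddCommGroup E] [NormedSpace ℂ E] [CompleteSpace E]
    [Module (↥N)ᵐᵒᵖ E] [HilbertModule N E] {n : ℕ} (ξ : Fin n → E) (η : E) :
    ip N (∑ i, ξ i) η = ∑ i, ip N (ξ i) η :=
  map_sum (AddMonoidHom.mk' (fun ξ => ip N ξ η) (fun a b => ip_add_left a b η)) ξ _

/-- The algebraic tensor product of `E` and `H`, to be given the inner product of `E ⊗_σ H`. -/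
def PreTensor (E : Type u) [NormedAddCommGroup E] [NormedSpace ℂ E] [CompleteSpace E]
    [Module (↥N)ᵐᵒᵖ E] [HilbertModule N E] (_σ : N →⋆ₙₐ[ℂ] (H →L[ℂ] H)) : Type (max u v) :=
  E ⊗[ℂ] H

variable {E : Type u} [NormedAddCommGroup E] [NormedSpace ℂ E] [CompleteSpace E]
  [Module (↥N)ᵐᵒᵖ E] [HilbertModule N E] (σ : N →⋆ₙₐ[ℂ] (H →L[ℂ] H))

instance : AddCommGroup (PreTensor E σ) := inferInstanceAs (AddCommGroup (E ⊗[ℂ] H))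
instance : Module ℂ (PreTensor E σ) := inferInstanceAs (Module ℂ (E ⊗[ℂ] H))

/-- The sesquilinear form with `⟨ξ ⊗ h, η ⊗ k⟩ = ⟨h, σ(⟨ξ, η⟩) k⟩`. -/
def tensorForm : (E ⊗[ℂ] H) →ₗ⋆[ℂ] (E ⊗[ℂ] H) →ₗ[ℂ] ℂ :=
  TensorProduct.lift <| LinearMap.mk₂'ₛₗ (starRingEnd ℂ) (starRingEnd ℂ)
    (fun ξ h => TensorProduct.lift <| LinearMap.mk₂ ℂ
      (fun η k => ⟪h, σ (ip N ξ η) k⟫_ℂ)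
      (by intro a b k; simp [ip, HilbertModule.ip_add_right])
      (by intro c a k; simp [ip, HilbertModule.ip_smul_right])
      (by intro a k l; simp)
      (by intro c a k; simp))
    (by intro a b k; ext; simp [ip_add_left])
    (by intro c a k; ext; simp [ip_smul_left])
    (by intro a k l; ext; simp)
    (by intro c a k; ext; simp [mul_comm])

@[simp] theorem tensorForm_tmul (ξ η : E) (h k : H) :
    tensorForm σ (ξ ⊗ₜ h) (η ⊗ₜ k) = ⟪h, σ (ip N ξ η) k⟫_ℂ := by
  simp [tensorForm]


theorem tensorForm_conj (x y : E ⊗[ℂ] H) :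
    (starRingEnd ℂ) (tensorForm σ y x) = tensorForm σ x y := by
  induction x using TensorProduct.induction_on with
  | zero => simp
  | add x₁ x₂ h₁ h₂ => simp [h₁, h₂]
  | tmul ξ h =>
    induction y using TensorProduct.induction_on with
    | zero => simp
    | add y₁ y₂ h₁ h₂ => simp [h₁, h₂]
    | tmul η k =>
      rw [tensorForm_tmul, tensorForm_tmul, inner_conj_symm,
        show ip N ξ η = star (ip N η ξ) from (HilbertModule.star_ip _ _).symm, map_star,
        ContinuousLinearMap.star_eq_adjoint, ContinuousLinearMap.adjoint_inner_right]

/-- The matrix `[⟨ξᵢ, ξⱼ⟩]` is positive, of the form `C⋆ C`, in the C⋆-algebra `M_n(N)`. -/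
theorem exists_gram_eq {n : ℕ} (ξ : Fin n → E) : ∃ C : Fin n → Fin n → N,
    ∀ i j, ip N (ξ i) (ξ j) = ∑ k, star (C k i) * C k j := by
  refine cstar_exists_factor _ (fun i j => HilbertModule.star_ip _ _) fun b => ?_
  obtain ⟨c, hc⟩ := HilbertModule.ip_self_nonneg (N := N) (∑ i, MulOpposite.op (b i) • ξ i)
  refine ⟨c, hc ▸ ?_⟩
  rw [← ip, ip_sum_left]
  refine Finset.sum_congr rfl fun i _ => ?_
  rw [ip_sum_right]
  refine Finset.sum_congr rfl fun j _ => ?_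
  have h (a c : N) (ζ η : E) : ip N (MulOpposite.op a • ζ) (MulOpposite.op c • η) =
      star a * ip N ζ η * c := by
    simp only [ip]
    rw [HilbertModule.ip_act_right, ← HilbertModule.star_ip, HilbertModule.ip_act_right,
      star_mul, HilbertModule.star_ip]
  exact (h _ _ _ _).symm

theorem tensorForm_self_nonneg (x : E ⊗[ℂ] H) : 0 ≤ RCLike.re (tensorForm σ x x) := by
  obtain ⟨n, ξ, h, rfl⟩ : ∃ (n : ℕ) (ξ : Fin n → E) (h : Fin n → H), x = ∑ i, ξ i ⊗ₜ[ℂ] h i := by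
    obtain ⟨s, rfl⟩ := TensorProduct.exists_finset x
    refine ⟨s.card, fun i => (s.equivFin.symm i).1.1, fun i => (s.equivFin.symm i).1.2, ?_⟩
    rw [← Finset.sum_coe_sort s, ← s.equivFin.symm.sum_comp]
  obtain ⟨C, hC⟩ := exists_gram_eq (N := N) ξ
  have : tensorForm σ (∑ i, ξ i ⊗ₜ[ℂ] h i) (∑ i, ξ i ⊗ₜ[ℂ] h i) =
      ∑ k, ⟪∑ i, σ (C k i) (h i), ∑ j, σ (C k j) (h j)⟫_ℂ := by
    have h1 (i j : Fin n) : ⟪h i, σ (ip N (ξ i) (ξ j)) (h j)⟫_ℂ =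
        ∑ k, ⟪σ (C k i) (h i), σ (C k j) (h j)⟫_ℂ := by
      rw [hC, map_sum, sum_apply, inner_sum]
      refine Finset.sum_congr rfl fun k _ => ?_
      rw [map_mul, map_star, ContinuousLinearMap.star_eq_adjoint, mul_apply_eq_comp,
        ContinuousLinearMap.adjoint_inner_right]
    simp only [map_sum, LinearMap.sum_apply, tensorForm_tmul, h1, inner_sum, sum_inner]
    conv_rhs => rw [Finset.sum_comm]
    exact Finset.sum_congr rfl fun _ _ => Finset.sum_comm
  rw [this, map_sum]
  exact Finset.sum_nonneg fun k _ => inner_self_nonneg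

/-- The positive semidefinite inner product on the algebraic tensor product. -/
abbrev tensorCore : PreInnerProductSpace.Core ℂ (PreTensor E σ) where
  inner x y := tensorForm σ x y
  conj_inner_symm x y := tensorForm_conj σ x y
  re_inner_nonneg x := tensorForm_self_nonneg σ x
  add_left _ _ _ := LinearMap.map_add₂ _ _ _ _
  smul_left _ _ _ := LinearMap.map_smulₛₗ₂ _ _ _ _

instance : SeminormedAddCommGroup (PreTensor E σ) :=
  InnerProductSpace.Core.toSeminormedAddCommGroup (c := tensorCore σ)
instance : InnerProductSpace ℂ (PreTensor E σ) :=
  InnerProductSpace.ofCore (tensorCore σ)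

/-- The Hilbert space `E ⊗_σ H`, the Hausdorff completion of the algebraic tensor product. -/
abbrev InteriorTensor (E : Type u) [NormedAddCommGroup E] [NormedSpace ℂ E] [CompleteSpace E]
    [Module (↥N)ᵐᵒᵖ E] [HilbertModule N E] (σ : N →⋆ₙₐ[ℂ] (H →L[ℂ] H)) : Type (max u v) :=
  UniformSpace.Completion (PreTensor E σ)

/-- The vector `ξ ⊗ h` of `E ⊗_σ H`. -/
def tensorVec (ξ : E) (h : H) : InteriorTensor E σ :=
  ((show PreTensor E σ from ξ ⊗ₜ[ℂ] h : PreTensor E σ) : UniformSpace.Completion (PreTensor E σ))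

theorem inner_tensorVec (ξ η : E) (h k : H) :
    ⟪tensorVec σ ξ h, tensorVec σ η k⟫_ℂ = ⟪h, σ (ip N ξ η) k⟫_ℂ := by
  rw [tensorVec, tensorVec, UniformSpace.Completion.inner_coe]
  exact tensorForm_tmul σ ξ η h k

end Interior

/-! ### Covariant representations and dilations -/

section Representations

variable {H₀ : Type w} [NormedAddCommGroup H₀] [InnerProductSpace ℂ H₀] [CompleteSpace H₀]
  (N : VonNeumannAlgebra H₀)

/-- Complete contractivity of `T : E → B(H)`.  The norm of `[ξᵢⱼ]` in `M_n(E)` is the square root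
of the norm of the matrix with entries `∑ₖ ⟨ξₖᵢ, ξₖⱼ⟩` in `M_n(N) ⊆ M_n(B(H₀))`. -/
def IsCompletelyContractive {E : Type u} [NormedAddCommGroup E] [NormedSpace ℂ E]
    [CompleteSpace E] [Module (↥N)ᵐᵒᵖ E] [HilbertModule N E]
    {H : Type v} [NormedAddCommGroup H] [InnerProductSpace ℂ H] [CompleteSpace H]
    (T : E →ₗ[ℂ] (H →L[ℂ] H)) : Prop :=
  ∀ (n : ℕ) (ξ : Fin n → Fin n → E),
    ‖CStarMatrix.ofMatrix (Matrix.of fun i j => T (ξ i j))‖ ^ 2 ≤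
      ‖CStarMatrix.ofMatrix (Matrix.of fun i j => ((∑ k, ip N (ξ k i) (ξ k j) : N) : H₀ →L[ℂ] H₀))‖

variable {N}
variable {E : ℝ≥0 → Type u}
  [∀ t, NormedAddCommGroup (E t)] [∀ t, NormedSpace ℂ (E t)] [∀ t, CompleteSpace (E t)]
  [∀ t, Module (↥N)ᵐᵒᵖ (E t)] [∀ t, WStarCorrespondence N (E t)]

/-- A (completely contractive) covariant representation on `H` of a discrete product system. -/
structure CovariantRep (P : DiscreteProductSystem N E)
    (H : Type v) [NormedAddCommGroup H] [InnerProductSpace ℂ H] [CompleteSpace H] where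
  T : ∀ t, E t →ₗ[ℂ] (H →L[ℂ] H)
  completelyContractive : ∀ t, IsCompletelyContractive N (T t)
  continuous : ∀ t, Continuous[sigmaTopology N (E t), sigmaWeak H] (T t)
  /-- `T 0`, as a `⋆`-representation of `N ≃ E 0` -/
  rep : N →⋆ₙₐ[ℂ] (H →L[ℂ] H)
  T_unit : ∀ a : N, T 0 (P.unit a) = rep a
  T_mul : ∀ {t s r : ℝ≥0} (h : t + s = r) (ξ : E t) (η : E s),
    T r (P.mul h ξ η) = T t ξ * T s η

variable {P : DiscreteProductSystem N E}

/-- `T_t(ξ)⋆ T_t(η) = T_0(⟨ξ, η⟩)` for all `t`. -/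
def CovariantRep.IsIsometric {H : Type v} [NormedAddCommGroup H] [InnerProductSpace ℂ H]
    [CompleteSpace H] (T : CovariantRep P H) : Prop :=
  ∀ t (ξ η : E t), star (T.T t ξ) * T.T t η = T.rep (ip N ξ η)

/-- `T̃_t T̃_t⋆ = I` for all `t`, where `T̃_t : E t ⊗ H → H` is the bounded operator
`ξ ⊗ h ↦ T_t(ξ) h`, the tensor product being taken over the representation `T_0` of `N`. -/
def CovariantRep.IsFullyCoisometric {H : Type v} [NormedAddCommGroup H] [InnerProductSpace ℂ H]
    [CompleteSpace H] (T : CovariantRep P H) : Prop :=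
  ∀ t, ∃ S : InteriorTensor (E t) T.rep →L[ℂ] H,
    (∀ (ξ : E t) (h : H), S (tensorVec T.rep ξ h) = T.T t ξ h) ∧
      S ∘L S.adjoint = ContinuousLinearMap.id ℂ H

/-- `(V, u₀, K)` is a minimal isometric dilation of `T`: `V` is a fully coisometric and isometric
covariant representation on `K` that compresses to `T`, its adjoints leave `u₀(H)` invariant, and
`K` is the smallest closed subspace that contains `u₀(H)` and reduces all `V_t(ξ)`. -/
structure IsMinimalIsometricDilation {H : Type v} [NormedAddCommGroup H] [InnerProductSpace ℂ H]
    [CompleteSpace H] (T : CovariantRep P H) {K : Type*} [NormedAddCommGroup K]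
    [InnerProductSpace ℂ K] [CompleteSpace K] (V : CovariantRep P K) (u₀ : H →ₗᵢ[ℂ] K) :
    Prop where
  fullyCoisometric : V.IsFullyCoisometric
  isometric : V.IsIsometric
  compression : ∀ t (ξ : E t),
    u₀.toContinuousLinearMap.adjoint ∘L V.T t ξ ∘L u₀.toContinuousLinearMap = T.T t ξ
  coinvariant : ∀ t (ξ : E t), ∀ x ∈ Set.range u₀, (V.T t ξ).adjoint x ∈ Set.range u₀
  minimal : ∀ M : Submodule ℂ K, IsClosed (M : Set K) → Set.range u₀ ⊆ M →
    (∀ t (ξ : E t), ∀ x ∈ M, V.T t ξ x ∈ M ∧ (V.T t ξ).adjoint x ∈ M) → M = ⊤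

end Representations

end ProductSystems

end

open ProductSystems

/-! Since `T̃_r` is a coisometry, `T̃_r⋆` embeds `H` isometrically in `E(r) ⊗ H`. It intertwines
inner products twisted by `N`, so `I ⊗ T̃_r⋆` is an isometry of `E(t) ⊗ H` into `E(t) ⊗ E(r) ⊗ H ≃
E(t+r) ⊗ H`. Multiplicativity, `T̃_{t+r} = T̃_t (I ⊗ T̃_r)`, makes these isometries a directed
system (`connect_tilde_adjoint`, `connect_connect`), and `K` is its inductive limit. Creation by `ξ
∈ E(t)` acts on the left leg and the connecting maps on the right one, so they commute and creation
passes to an operator `V_t(ξ)` on `K`. It is isometric in the sense of covariant representations by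
the definition of the inner product. Level `s` of the limit sits in level `t+s`, which is generated
by `E(t)` acting on level `s`; hence the isometry `Ṽ_t` has dense range and is unitary. The space
`H` embeds by `T̃_0⋆`, which in the limit agrees with every `T̃_t⋆`. From this come `V_t(ξ)⋆ u₀ = u₀
T_t(ξ)⋆` and `V_t(ξ) u₀ h = ξ ⊗ h`, that is, coinvariance, compression and minimality.

For uniqueness, the inner products of the vectors `V'_t(ξ) u₀' h` are determined by `T`, so `ξ ⊗ h ↦
V'_t(ξ) u₀' h` is isometric on each level. These maps are compatible and define an isometry `K → K'`
that intertwines the representations; its range is reducing, so it is all of `K'` by minimality.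

The analytic difficulty is that products are only `σ`-dense in `E(t+s)`, and that `V_t` must be
continuous from the `σ`-topology to the σ-weak one. Both rest on `sigmaTopology_continuous_inner`:
if `⟨Lξ, Lη⟩ = w(⟨ξ, η⟩)` with `w` normal, then each `⟨x, L ·⟩` is one of the functionals that
define the `σ`-topology. Normality of `V_0` needs the predual to be norm closed
(`isClosed_predual`), which is proved from the double commutant theorem. -/

noncomputable section

namespace ProductSystems

/-! ### σ-weakly continuous functionals given by square-summable families. -/

section Predual

theorem summable_sq_norm_lp {ι K : Type*} [NormedAddCommGroup K] (x : lp (fun _ : ι => K) 2) :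
    Summable fun i => ‖x i‖ ^ 2 := by
  simpa using (lp.memℓp x).summable (by norm_num)

theorem summable_norm_mul_norm_lp {ι K : Type*} [NormedAddCommGroup K] (x y : lp (fun _ : ι => K) 2) :
    Summable fun i => ‖x i‖ * ‖y i‖ := by
  refine Summable.of_nonneg_of_le (fun _ => by positivity) (fun i => ?_)
    ((summable_sq_norm_lp x).add (summable_sq_norm_lp y))
  nlinarith [sq_nonneg (‖x i‖ - ‖y i‖), sq_nonneg ‖x i‖, sq_nonneg ‖y i‖]

variable {H : Type v} [NormedAddCommGroup H] [InnerProductSpace ℂ H]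

theorem summable_inner_apply {ι : Type*} (x y : lp (fun _ : ι => H) 2) (S : H →L[ℂ] H) :
    Summable fun i => ⟪x i, S (y i)⟫_ℂ := by
  refine Summable.of_norm_bounded ((summable_norm_mul_norm_lp x y).mul_left ‖S‖) fun i => ?_
  calc ‖⟪x i, S (y i)⟫_ℂ‖ ≤ ‖x i‖ * (‖S‖ * ‖y i‖) :=
        (norm_inner_le_norm _ _).trans (by gcongr; exact S.le_opNorm _)
    _ = ‖S‖ * (‖x i‖ * ‖y i‖) := by ring

theorem sigmaWeak_continuous_tsum (x y : lp (fun _ : ℕ => H) 2) :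
    Continuous[sigmaWeak H, inferInstance] fun S : H →L[ℂ] H => ∑' n, ⟪x n, S (y n)⟫_ℂ :=
  continuous_iInf_dom (i := x) (continuous_iInf_dom (i := y) continuous_induced_dom)

/-- The functionals `S ↦ ∑ᵢ ⟨xᵢ, S yᵢ⟩` over an arbitrary index type are σ-weakly continuous. -/
theorem sigmaWeak_continuous_tsum_of_lp {ι : Type*} (x y : lp (fun _ : ι => H) 2) :
    Continuous[sigmaWeak H, inferInstance] fun S : H →L[ℂ] H => ∑' i, ⟪x i, S (y i)⟫_ℂ := by
  have hc : (Function.support fun i => ‖x i‖ ^ 2).Countable := (summable_sq_norm_lp x).countable_support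
  set A := Function.support fun i => ‖x i‖ ^ 2
  -- Only the countable support of `x` contributes to the sum; it is moved into `ℕ` by an injection,
  -- and both families are extended by zero.
  obtain ⟨e, he⟩ := hc.to_subtype.exists_injective_nat
  have hm (z : lp (fun _ : ι => H) 2) :
      Memℓp (E := fun _ : ℕ => H) (Function.extend e (fun i : A => z i) 0) 2 := by
    refine memℓp_gen ?_
    have h1 : (fun n => ‖Function.extend e (fun i : A => z i) 0 n‖ ^ (2 : ENNReal).toReal) =
        Function.extend e (fun i : A => ‖z i‖ ^ 2) 0 := by
      funext n
      by_cases hn : ∃ i, e i = n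
      · obtain ⟨i, rfl⟩ := hn
        simp [he.extend_apply]
      · simp [Function.extend_apply' _ _ _ hn]
    rw [h1, summable_extend_zero he]
    exact (summable_sq_norm_lp z).subtype A
  convert sigmaWeak_continuous_tsum ⟨_, hm x⟩ ⟨_, hm y⟩ using 1
  funext S
  have h2 : (fun n => ⟪Function.extend e (fun i : A => x i) 0 n,
      S (Function.extend e (fun i : A => y i) 0 n)⟫_ℂ) =
      Function.extend e (fun i : A => ⟪x i, S (y i)⟫_ℂ) 0 := by
    funext n
    by_cases hn : ∃ i, e i = n
    · obtain ⟨i, rfl⟩ := hn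
      simp [he.extend_apply]
    · simp [Function.extend_apply' _ _ _ hn]
  refine Eq.trans ?_ (congrArg tsum h2).symm
  rw [tsum_extend_zero he]
  refine (tsum_subtype_eq_of_support_subset (f := fun i => ⟪x i, S (y i)⟫_ℂ) ?_).symm
  intro i hi
  simp only [A, Function.mem_support] at hi ⊢
  contrapose! hi
  simp_all

end Predual

/-! ### The predual as a quotient of `ℓ¹`, and its norm closedness. -/

section PredualClosed

variable {H₀ : Type w} [NormedAddCommGroup H₀] [InnerProductSpace ℂ H₀] [CompleteSpace H₀]
  (N : VonNeumannAlgebra H₀)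

/-- The functional `a ↦ ∑ₙ ⟨xₙ, a yₙ⟩` on `N`. -/
def vecFunctional (x y : lp (fun _ : ℕ => H₀) 2) : N →ₗ[ℂ] ℂ where
  toFun a := ∑' n, ⟪x n, (a : H₀ →L[ℂ] H₀) (y n)⟫_ℂ
  map_add' a b := by
    rw [← (summable_inner_apply x y a).tsum_add (summable_inner_apply x y b)]
    simp
  map_smul' c a := by
    simp [tsum_mul_left]

/-- For the coarsest topology that makes a family of linear functionals continuous, the continuous
linear functionals are exactly their finite linear combinations. -/
theorem mem_predual_iff_mem_span (f : StrongDual ℂ N) : f ∈ predual N ↔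
    (f : N →ₗ[ℂ] ℂ) ∈ Submodule.span ℂ (Set.range fun p : lp (fun _ : ℕ => H₀) 2 ×
      lp (fun _ : ℕ => H₀) 2 => vecFunctional N p.1 p.2) := by
  rw [LinearMap.mem_span_iff_continuous]
  have : sigmaWeakOn N = ⨅ p : lp (fun _ : ℕ => H₀) 2 × lp (fun _ : ℕ => H₀) 2,
      TopologicalSpace.induced (vecFunctional N p.1 p.2) inferInstance := by
    simp only [sigmaWeakOn, sigmaWeak, induced_iInf, induced_compose, iInf_prod]
    rfl
  change Continuous[sigmaWeakOn N, inferInstance] f ↔ _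
  rw [this]
  rfl

/-- Pairs of vectors in the unit ball. -/
abbrev BallPair (H₀ : Type w) [NormedAddCommGroup H₀] : Type w :=
  {p : H₀ × H₀ // ‖p.1‖ ≤ 1 ∧ ‖p.2‖ ≤ 1}

omit [CompleteSpace H₀] in
theorem norm_inner_ballPair_le (p : BallPair H₀) (a : H₀ →L[ℂ] H₀) :
    ‖⟪p.1.1, a p.1.2⟫_ℂ‖ ≤ ‖a‖ := by
  refine (norm_inner_le_norm _ _).trans ?_
  have := a.le_opNorm p.1.2
  have h1 := p.2.1
  have h2 := p.2.2
  calc _ ≤ 1 * (‖a‖ * 1) := by gcongr; exact this.trans (by gcongr)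
    _ = _ := by ring

theorem summable_norm_lp_one {ι : Type*} (c : lp (fun _ : ι => ℂ) 1) :
    Summable fun i => ‖c i‖ := by
  simpa using (lp.memℓp c).summable (by norm_num)

theorem norm_lp_one {ι : Type*} (c : lp (fun _ : ι => ℂ) 1) : ‖c‖ = ∑' i, ‖c i‖ := by
  have := lp.norm_rpow_eq_tsum (p := 1) (by norm_num) c
  simpa using this

omit [CompleteSpace H₀] in
theorem summable_ballPair (c : lp (fun _ : BallPair H₀ => ℂ) 1) (a : H₀ →L[ℂ] H₀) :
    Summable fun p : BallPair H₀ => ‖c p * ⟪p.1.1, a p.1.2⟫_ℂ‖ := by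
  refine Summable.of_nonneg_of_le (fun _ => norm_nonneg _) (fun p => ?_)
    ((summable_norm_lp_one c).mul_right ‖a‖)
  rw [norm_mul]
  gcongr
  exact norm_inner_ballPair_le p a

/-- The map that takes `c ∈ ℓ¹` to the functional `a ↦ ∑_{(x, y)} c_{(x, y)} ⟨x, a y⟩` on `N`. -/
def ballFunctional : lp (fun _ : BallPair H₀ => ℂ) 1 →L[ℂ] StrongDual ℂ N :=
  LinearMap.mkContinuous₂ (LinearMap.mk₂ ℂ
    (fun c (a : N) => ∑' p : BallPair H₀, c p * ⟪p.1.1, (a : H₀ →L[ℂ] H₀) p.1.2⟫_ℂ)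
    (fun c d a => by
      rw [← (summable_ballPair c _).of_norm.tsum_add (summable_ballPair d _).of_norm]
      simp [add_mul])
    (fun k c a => by simp [mul_assoc, tsum_mul_left])
    (fun c a b => by
      rw [← (summable_ballPair c _).of_norm.tsum_add (summable_ballPair c _).of_norm]
      simp [mul_add])
    (fun k c a => by
      rw [smul_eq_mul, ← tsum_mul_left]
      simp [mul_left_comm])) 1 (fun c a => by
    simp only [LinearMap.mk₂_apply, one_mul]
    refine (norm_tsum_le_tsum_norm (summable_ballPair c _)).trans ?_
    rw [norm_lp_one, ← tsum_mul_right]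
    refine (summable_ballPair c _).tsum_le_tsum (fun p => ?_)
      ((summable_norm_lp_one c).mul_right _)
    rw [norm_mul]
    gcongr
    exact norm_inner_ballPair_le p a)

theorem ballFunctional_apply (c : lp (fun _ : BallPair H₀ => ℂ) 1) (a : N) :
    ballFunctional N c a =
      ∑' p : BallPair H₀, c p * ⟪p.1.1, (a : H₀ →L[ℂ] H₀) p.1.2⟫_ℂ := rfl

theorem ballFunctional_single [DecidableEq (BallPair H₀)] (p : BallPair H₀) (k : ℂ) (a : N) :
    ballFunctional N (lp.single 1 p k) a = k * ⟪p.1.1, (a : H₀ →L[ℂ] H₀) p.1.2⟫_ℂ := by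
  rw [ballFunctional_apply, tsum_eq_single p]
  · simp
  · intro q hq
    simp [hq]

/-- One coefficient `‖x‖ ‖y‖` at the pair of normalised vectors suffices; a zero vector is
normalised to zero. The norm bound lets series of such representatives converge in `ℓ¹`. -/
theorem exists_ballFunctional_eq_inner (x y : H₀) :
    ∃ c : lp (fun _ : BallPair H₀ => ℂ) 1, ‖c‖ ≤ ‖x‖ * ‖y‖ ∧
      ∀ a : N, ballFunctional N c a = ⟪x, (a : H₀ →L[ℂ] H₀) y⟫_ℂ := by
  classical
  have hb (z : H₀) : ‖((‖z‖⁻¹ : ℝ) : ℂ) • z‖ ≤ 1 := by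
    rw [norm_smul]
    simp only [Complex.norm_real, norm_inv, norm_norm]
    exact inv_mul_le_one
  have hz (z : H₀) : ((‖z‖ : ℝ) : ℂ) • ((‖z‖⁻¹ : ℝ) : ℂ) • z = z := by
    by_cases h : z = 0
    · simp [h]
    · rw [smul_smul, ← Complex.ofReal_mul, mul_inv_cancel₀ (norm_ne_zero_iff.mpr h)]; simp
  refine ⟨lp.single 1 ⟨(_, _), hb x, hb y⟩ (‖x‖ * ‖y‖ : ℂ), ?_, fun a => ?_⟩
  · rw [lp.norm_single (by norm_num)]; simp
  · rw [ballFunctional_single]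
    conv_rhs => rw [← hz x, ← hz y]
    simp only [map_smul, inner_smul_left, inner_smul_right, Complex.conj_ofReal, mul_assoc]
    ring

/-- The coefficient is split as `c = √|c| · (c / √|c|)`, one factor for each vector. Both factors
have modulus `√|c|`, so both families are square summable. The quotient is 0 where `c` vanishes. -/
theorem ballFunctional_mem_predual (c : lp (fun _ : BallPair H₀ => ℂ) 1) :
    ballFunctional N c ∈ predual N := by
  have hs := summable_norm_lp_one c
  have hx : Memℓp (E := fun _ : BallPair H₀ => H₀)
      (fun p => ((Real.sqrt ‖c p‖ : ℝ) : ℂ) • p.1.1) 2 := by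
    refine memℓp_gen (Summable.of_nonneg_of_le (fun _ => by positivity) (fun p => ?_) hs)
    have := p.2.1
    have h2 : ‖p.1.1‖ ^ 2 ≤ 1 := pow_le_one₀ (norm_nonneg _) this
    simp only [ENNReal.toReal_ofNat, Real.rpow_ofNat, norm_smul, Complex.norm_real, mul_pow,
      Real.norm_eq_abs, sq_abs, Real.sq_sqrt (norm_nonneg _)]
    exact mul_le_of_le_one_right (norm_nonneg _) h2
  have hy : Memℓp (E := fun _ : BallPair H₀ => H₀)
      (fun p => (c p / ((Real.sqrt ‖c p‖ : ℝ) : ℂ)) • p.1.2) 2 := by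
    refine memℓp_gen (Summable.of_nonneg_of_le (fun _ => by positivity) (fun p => ?_) hs)
    have := p.2.2
    have h2 : ‖p.1.2‖ ^ 2 ≤ 1 := pow_le_one₀ (norm_nonneg _) this
    simp only [ENNReal.toReal_ofNat, Real.rpow_ofNat, norm_smul, Complex.norm_real, mul_pow,
      Real.norm_eq_abs, sq_abs, Real.sq_sqrt (norm_nonneg _), norm_div, div_pow]
    refine (mul_le_of_le_one_right (by positivity) h2).trans (le_of_eq ?_)
    by_cases h0 : ‖c p‖ = 0
    · simp [h0]
    · field_simp
  have h := sigmaWeak_continuous_tsum_of_lp (⟨_, hx⟩ : lp (fun _ : BallPair H₀ => H₀) 2) ⟨_, hy⟩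
  have h' := @Continuous.comp _ _ _ (sigmaWeakOn N) (sigmaWeak H₀) _ _ _ h
    (@continuous_induced_dom _ _ (fun a : N => (a : H₀ →L[ℂ] H₀)) (sigmaWeak H₀))
  change Continuous[sigmaWeakOn N, inferInstance] _
  convert h' using 1
  funext a
  rw [ballFunctional_apply]
  refine tsum_congr fun p => ?_
  simp only [map_smul, inner_smul_left, inner_smul_right, Complex.conj_ofReal]
  by_cases h0 : c p = 0
  · simp [h0]
  · have : ((Real.sqrt ‖c p‖ : ℝ) : ℂ) ≠ 0 := by
      rw [Ne, Complex.ofReal_eq_zero, Real.sqrt_eq_zero (norm_nonneg _)]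
      simpa using h0
    field_simp

/-- Since `∑ ‖xₙ‖ ‖yₙ‖ < ∞`, a functional `∑ ⟨xₙ, · yₙ⟩` has a representative in `ℓ¹`. Closedness of
the predual becomes a closed range question for a bounded operator on a Banach space. -/
theorem predual_eq_range : predual N = Set.range (ballFunctional N) := by
  refine Set.Subset.antisymm (fun f hf => ?_) ?_
  · rw [mem_predual_iff_mem_span] at hf
    let R : Submodule ℂ (N →ₗ[ℂ] ℂ) :=
      (ballFunctional N).toLinearMap.range.map (ContinuousLinearMap.coeLM ℂ)
    have hR : Submodule.span ℂ (Set.range fun p : lp (fun _ : ℕ => H₀) 2 ×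
        lp (fun _ : ℕ => H₀) 2 => vecFunctional N p.1 p.2) ≤ R := by
      rw [Submodule.span_le]
      rintro _ ⟨⟨x, y⟩, rfl⟩
      choose c hc hc' using fun n => exists_ballFunctional_eq_inner N (x n) (y n)
      have hs : Summable c := Summable.of_norm_bounded (summable_norm_mul_norm_lp x y) hc
      refine ⟨ballFunctional N (∑' n, c n), ⟨_, rfl⟩, ?_⟩
      ext a
      have h1 := ((ContinuousLinearMap.apply ℂ ℂ a) ∘L ballFunctional N).map_tsum hs
      simp only [ContinuousLinearMap.comp_apply, ContinuousLinearMap.apply_apply, hc'] at h1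
      exact h1
    obtain ⟨_, ⟨c, rfl⟩, hc⟩ := hR hf
    refine ⟨c, ?_⟩
    ext a
    exact congrArg (fun g : N →ₗ[ℂ] ℂ => g a) hc
  · rintro _ ⟨c, rfl⟩
    exact ballFunctional_mem_predual N c

/-- A bounded functional on `ℓ¹` that factors through `ballFunctional` is the evaluation at an
element of `N`, by the double commutant theorem. -/
theorem exists_eval_of_factors (Λ : lp (fun _ : BallPair H₀ => ℂ) 1 →L[ℂ] ℂ) (hΛ : ‖Λ‖ ≤ 1)
    (hker : ∀ c, ballFunctional N c = 0 → Λ c = 0) :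
    ∃ b : N, ‖b‖ ≤ 1 ∧ ∀ c, Λ c = ballFunctional N c b := by
  classical
  have heq (c d) (h : ∀ a, ballFunctional N c a = ballFunctional N d a) : Λ c = Λ d := by
    rw [← sub_eq_zero, ← map_sub]
    refine hker _ ?_
    ext a
    simp [h]
  choose e he he' using exists_ballFunctional_eq_inner N
  have hbd (x y : H₀) : ‖Λ (e x y)‖ ≤ ‖x‖ * ‖y‖ := by
    refine (Λ.le_opNorm _).trans ?_
    calc _ ≤ 1 * (‖x‖ * ‖y‖) := by gcongr; exact he x y
      _ = _ := one_mul _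
  -- The choice of `e x y` is not linear, but `Λ` sees only the functional that it represents, which
  -- is sesquilinear in `x` and `y`.
  let B : H₀ →L⋆[ℂ] H₀ →L[ℂ] ℂ := LinearMap.mkContinuous₂
    (LinearMap.mk₂'ₛₗ (starRingEnd ℂ) (RingHom.id ℂ) (fun x y => Λ (e x y))
      (fun x x' y => by
        rw [← map_add]; refine heq _ _ fun a => ?_
        simp [he'])
      (fun k x y => by
        rw [← map_smul]; refine heq _ _ fun a => ?_
        simp [he', mul_comm])
      (fun x y y' => by
        rw [← map_add]; refine heq _ _ fun a => ?_
        simp [he'])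
      (fun k x y => by
        rw [RingHom.id_apply, ← map_smul]; refine heq _ _ fun a => ?_
        simp [he'])) 1 (fun x y => by simpa using hbd x y)
  let b : H₀ →L[ℂ] H₀ := (InnerProductSpace.continuousLinearMapOfBilin B).adjoint
  have hb (x y) : ⟪x, b y⟫_ℂ = Λ (e x y) := by
    rw [ContinuousLinearMap.adjoint_inner_right,
      InnerProductSpace.continuousLinearMapOfBilin_apply]
    rfl
  have hbN : b ∈ N := by
    have : b ∈ (N : Set (H₀ →L[ℂ] H₀)) := by
      rw [← N.centralizer_centralizer, Set.mem_centralizer_iff]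
      intro m hm
      rw [Set.mem_centralizer_iff] at hm
      ext y
      refine ext_inner_left ℂ fun x => ?_
      change ⟪x, m (b y)⟫_ℂ = ⟪x, b (m y)⟫_ℂ
      -- For `m` in the commutant, `e (m⋆ x) y` and `e x (m y)` represent the same functional on
      -- `N`, so `Λ` takes the same value on them.
      rw [← ContinuousLinearMap.adjoint_inner_left, hb, hb]
      refine heq _ _ fun a => ?_
      rw [he', he', ContinuousLinearMap.adjoint_inner_left]
      have := congrArg (fun T : H₀ →L[ℂ] H₀ => T y) (hm a a.2)
      exact congrArg (fun z => ⟪x, z⟫_ℂ) this.symm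
    exact this
  refine ⟨⟨b, hbN⟩, ?_, fun c => ?_⟩
  · change ‖b‖ ≤ 1
    refine b.opNorm_le_bound zero_le_one fun y => ?_
    rw [one_mul]
    have h1 := hbd (b y) y
    rw [← hb, inner_self_eq_norm_sq_to_K, norm_pow, RCLike.norm_ofReal, abs_norm, sq] at h1
    rcases (norm_nonneg (b y)).eq_or_lt with h2 | h2
    · rw [← h2]; exact norm_nonneg y
    · exact le_of_mul_le_mul_left h1 h2
  · have h1 := lp.hasSum_single (by norm_num) c
    have h2 := Λ.hasSum h1
    have h3 := ((ContinuousLinearMap.apply ℂ ℂ (⟨b, hbN⟩ : N)) ∘L ballFunctional N).hasSum h1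
    suffices h : (fun p => Λ (lp.single 1 p (c p))) = fun p =>
        ((ContinuousLinearMap.apply ℂ ℂ (⟨b, hbN⟩ : N)) ∘L ballFunctional N)
          (lp.single 1 p (c p)) by
      rw [h] at h2
      exact h2.unique h3
    funext p
    simp only [ContinuousLinearMap.comp_apply, ContinuousLinearMap.apply_apply]
    rw [ballFunctional_single]
    change _ = c p * ⟪p.1.1, b p.1.2⟫_ℂ
    rw [hb, ← smul_eq_mul, ← map_smul]
    refine heq _ _ fun a => ?_
    simp [ballFunctional_single, he']

/-- A norming functional for the class of `c` in `ℓ¹ / ker` is evaluation at some `b` in the unit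
ball of `N`. So the quotient norm of `c` is at most `‖ballFunctional N c‖`, and a bounded operator
with such a lower bound has closed range. -/
theorem isClosed_predual : IsClosed (predual N) := by
  let f : NormedAddGroupHom (lp (fun _ : BallPair H₀ => ℂ) 1) (StrongDual ℂ N) :=
    (ballFunctional N).toLinearMap.toAddMonoidHom.mkNormedAddGroupHom ‖ballFunctional N‖
      (ballFunctional N).le_opNorm
  -- The quotient norm is an infimum. A representative is taken within `‖ballFunctional N c‖` of it,
  -- which gives the constant 2 and needs the zero case apart.
  have hf : f.SurjectiveOnWith f.range 2 := by
    rintro _ ⟨c, rfl⟩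
    change ∃ d, ballFunctional N d = ballFunctional N c ∧ ‖d‖ ≤ 2 * ‖ballFunctional N c‖
    by_cases h0 : ballFunctional N c = 0
    · exact ⟨0, by simp [h0], by simp⟩
    let Z := (ballFunctional N).toLinearMap.ker
    have hZ : IsClosed (Z : Set (lp (fun _ : BallPair H₀ => ℂ) 1)) :=
      (ballFunctional N).isClosed_ker
    obtain ⟨g, hg, hgc⟩ := exists_dual_vector'' ℂ (Z.mkQ c)
    let Λ : lp (fun _ : BallPair H₀ => ℂ) 1 →L[ℂ] ℂ :=
      (g.toLinearMap ∘ₗ Z.mkQ).mkContinuous 1 fun x => by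
        refine (g.le_opNorm _).trans ?_
        gcongr
        exact Submodule.Quotient.norm_mk_le Z x
    obtain ⟨b, hb, hΛb⟩ := exists_eval_of_factors N Λ
      (LinearMap.mkContinuous_norm_le _ zero_le_one _) fun x hx => by
        have : Z.mkQ x = 0 := by simpa [Z] using hx
        change g (Z.mkQ x) = 0
        rw [this, map_zero]
    have h1 : ‖Z.mkQ c‖ ≤ ‖ballFunctional N c‖ := by
      have h2 : ((‖Z.mkQ c‖ : ℝ) : ℂ) = ballFunctional N c b := hgc.symm.trans (hΛb c)
      calc ‖Z.mkQ c‖ = ‖ballFunctional N c b‖ := by rw [← h2]; simp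
        _ ≤ ‖ballFunctional N c‖ * ‖b‖ := (ballFunctional N c).le_opNorm b
        _ ≤ ‖ballFunctional N c‖ * 1 := by gcongr
        _ = _ := mul_one _
    obtain ⟨d, hd, hd'⟩ := Submodule.Quotient.norm_mk_lt (S := Z) (Z.mkQ c) (norm_pos_iff.mpr h0)
    refine ⟨d, ?_, by linarith⟩
    have : d - c ∈ Z := (Submodule.Quotient.eq Z).mp hd
    rw [← sub_eq_zero, ← map_sub]
    exact this
  have h := controlled_closure_of_complete two_pos one_pos hf
  rw [predual_eq_range]
  refine isClosed_of_closure_subset fun g hg => ?_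
  obtain ⟨d, hd, -⟩ := h g hg
  exact ⟨d, hd⟩

end PredualClosed

/-! ### Continuity of inner products in the `σ`-topology. -/

section Normal

variable {H₀ : Type w} [NormedAddCommGroup H₀] [InnerProductSpace ℂ H₀] [CompleteSpace H₀]
  {N : VonNeumannAlgebra H₀}

/-- A positive element of a C⋆-algebra, perturbed by `δ > 0`, has an invertible square root. -/
theorem exists_invertible_sqrt {A : Type*} [CStarAlgebra A] (c : A) {δ : ℝ} (hδ : 0 < δ) :
    ∃ b k : A, star b = b ∧ star k = k ∧ b * b = star c * c + (δ : ℂ) • 1 ∧ k * b = 1 ∧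
      ‖k * (star c * c) * k‖ ≤ 1 := by
  let _ : PartialOrder A := CStarAlgebra.spectralOrder A
  have _ : StarOrderedRing A := CStarAlgebra.spectralOrderedRing A
  have ha : 0 ≤ star c * c := star_mul_self_nonneg c
  have h1 : (0 : A) ≤ (δ : ℂ) • 1 := by
    rw [← Algebra.algebraMap_eq_smul_one]
    have : (algebraMap ℂ A) (δ : ℂ) = algebraMap ℝ A δ := by
      rw [IsScalarTower.algebraMap_apply ℝ ℂ A]; rfl
    rw [this]
    exact algebraMap_nonneg A hδ.le
  set s := star c * c + (δ : ℂ) • (1 : A) with hs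
  have hs0 : 0 ≤ s := add_nonneg ha h1
  have hsu : IsUnit s := by
    refine CStarAlgebra.isUnit_of_le ((δ : ℂ) • (1 : A)) (le_add_of_nonneg_left ha) ⟨h1, ?_⟩
    rw [← Algebra.algebraMap_eq_smul_one]
    exact (IsUnit.mk0 (δ : ℂ) (by exact_mod_cast hδ.ne')).map (algebraMap ℂ A)
  have hb0 : 0 ≤ CFC.sqrt s := CFC.sqrt_nonneg s
  have hbb : CFC.sqrt s * CFC.sqrt s = s := CFC.sqrt_mul_sqrt_self s hs0
  have hbu : IsUnit (CFC.sqrt s) := by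
    refine (Commute.isUnit_mul_iff (Commute.refl _)).mp ?_ |>.1
    rwa [hbb]
  obtain ⟨v, hv⟩ := hbu
  have hbs : star (v : A) = v := by rw [hv]; exact hb0.isSelfAdjoint
  have hks : star ((v⁻¹ : Aˣ) : A) = (v⁻¹ : Aˣ) := by
    have := congrArg (fun w : Aˣ => (w⁻¹ : Aˣ)) (show star v = v from Units.ext hbs)
    simpa using congrArg Units.val this
  refine ⟨v, (v⁻¹ : Aˣ), hbs, hks, ?_, v.inv_mul, ?_⟩
  · rw [hv, hbb]
  · have h2 : (v⁻¹ : Aˣ) * (star c * c) * (v⁻¹ : Aˣ) =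
        1 - (δ : ℂ) • (star ((v⁻¹ : Aˣ) : A) * (v⁻¹ : Aˣ)) := by
      have : star c * c = v * v - (δ : ℂ) • (1 : A) := by rw [hv, hbb, hs]; simp
      rw [this, hks]
      simp [mul_sub, sub_mul]
    have h3 : 0 ≤ (v⁻¹ : Aˣ) * (star c * c) * (v⁻¹ : Aˣ) := by
      have := star_left_conjugate_nonneg ha ((v⁻¹ : Aˣ) : A)
      rwa [hks] at this
    rw [CStarAlgebra.norm_le_one_iff_of_nonneg _ h3, h2]
    refine sub_le_self _ ?_
    have := star_left_conjugate_nonneg h1 ((v⁻¹ : Aˣ) : A)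
    simpa using this

section Module

variable {E : Type u} [NormedAddCommGroup E] [NormedSpace ℂ E] [CompleteSpace E]
  [Module (↥N)ᵐᵒᵖ E] [HilbertModule N E]

theorem ip_act_left (a : N) (ξ η : E) : ip N (MulOpposite.op a • ξ) η = star a * ip N ξ η := by
  simp only [ip]
  rw [← HilbertModule.star_ip, HilbertModule.ip_act_right, star_mul, HilbertModule.star_ip]

/-- `ξ = ξ' (⟨ξ, ξ⟩ + δ)^{1/2}` with `ξ'` in the unit ball. -/
theorem exists_factor_unitBall (ξ : E) {δ : ℝ} (hδ : 0 < δ) :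
    ∃ (ξ' : E) (b : N), star b = b ∧ b * b = ip N ξ ξ + (δ : ℂ) • 1 ∧ ‖ξ'‖ ≤ 1 ∧
      ∀ η, ip N ξ η = b * ip N ξ' η := by
  obtain ⟨c, hc⟩ := HilbertModule.ip_self_nonneg (N := N) ξ
  obtain ⟨b, k, hb, hk, hbb, hkb, hn⟩ := exists_invertible_sqrt c hδ
  refine ⟨MulOpposite.op k • ξ, b, hb, by rw [hbb, ip, hc], ?_, fun η => ?_⟩
  · have : ‖MulOpposite.op k • ξ‖ ^ 2 ≤ 1 := by
      rw [HilbertModule.norm_sq (N := N), ← ip, ip_act_left, ip, HilbertModule.ip_act_right, hc, hk,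
        ← mul_assoc]
      exact hn
    exact (sq_le_one_iff₀ (norm_nonneg _)).mp this
  · rw [ip_act_left, ← mul_assoc, hk]
    have : b * k = 1 := by
      have := congrArg star hkb
      rwa [star_mul, hb, hk, star_one] at this
    rw [this, one_mul]

/-- As `⟨x, b a y⟩ = ⟨b⋆ x, a y⟩`, multiplication by `b` only replaces the square-summable sequence
`xₙ` by `b⋆ xₙ`. -/
theorem predual_comp_mul_left {f : StrongDual ℂ N} (hf : f ∈ predual N) (b : N) :
    f ∘L ContinuousLinearMap.mul ℂ N b ∈ predual N := by
  change Continuous[sigmaWeakOn N, inferInstance] (f ∘ fun a => b * a)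
  refine @Continuous.comp _ _ _ (sigmaWeakOn N) (sigmaWeakOn N) _ _ _ hf ?_
  rw [continuous_induced_rng, continuous_iInf_rng]
  intro x
  rw [continuous_iInf_rng]
  intro y
  rw [continuous_induced_rng]
  have hx : Memℓp (E := fun _ : ℕ => H₀) (fun n => (b : H₀ →L[ℂ] H₀).adjoint (x n)) 2 := by
    have h1 := ((lp.memℓp x).summable (by norm_num)).mul_left
      (‖(b : H₀ →L[ℂ] H₀).adjoint‖ ^ (2 : ENNReal).toReal)
    refine memℓp_gen (Summable.of_nonneg_of_le (fun _ => by positivity) (fun n => ?_) h1)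
    rw [← Real.mul_rpow (norm_nonneg _) (norm_nonneg _)]
    exact Real.rpow_le_rpow (norm_nonneg _) (ContinuousLinearMap.le_opNorm _ _) (by norm_num)
  convert @Continuous.comp _ _ _ (sigmaWeakOn N) (sigmaWeak H₀) _ _ _
    (sigmaWeak_continuous_tsum ⟨_, hx⟩ y)
    (@continuous_induced_dom _ _ (fun a : N => (a : H₀ →L[ℂ] H₀)) (sigmaWeak H₀)) using 1
  funext a
  refine tsum_congr fun n => ?_
  exact (ContinuousLinearMap.adjoint_inner_left (b : H₀ →L[ℂ] H₀) _ _).symm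

theorem sigmaTopology_continuous_tsum (f : ℕ → StrongDual ℂ N) (η : ℕ → E)
    (hf : ∀ n, f n ∈ predual N) (hs : Summable fun n => ‖f n‖ * ‖η n‖) :
    Continuous[sigmaTopology N E, inferInstance] fun ξ : E => ∑' n, f n (ip N (η n) ξ) :=
  continuous_iInf_dom (i := f) <| continuous_iInf_dom (i := η) <| continuous_iInf_dom (i := hf) <|
    continuous_iInf_dom (i := hs) continuous_induced_dom

variable {M M' : Type*} [NormedAddCommGroup M] [InnerProductSpace ℂ M] [CompleteSpace M]
  [NormedAddCommGroup M'] [InnerProductSpace ℂ M']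

/-- If `⟨L ξ, L η⟩ = w(⟨ξ, η⟩)` for a normal positive functional `w` (with GNS map `J`), then `L` is
continuous from the `σ`-topology to the weak topology. -/
theorem sigmaTopology_continuous_inner (L : E →ₗ[ℂ] M) (J : N →L[ℂ] M') (w : StrongDual ℂ N)
    (hw : w ∈ predual N) (hL : ∀ ξ η, ⟪L ξ, L η⟫_ℂ = w (ip N ξ η))
    (hJ : ∀ a b : N, ⟪J a, J b⟫_ℂ = w (star a * b)) (x : M) :
    Continuous[sigmaTopology N E, inferInstance] fun ξ : E => ⟪x, L ξ⟫_ℂ := by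
  set R := L.range.topologicalClosure with hR
  have : R.HasOrthogonalProjection := by
    have : CompleteSpace R := L.range.isClosed_topologicalClosure.completeSpace_coe
    infer_instance
  set p : M := R.starProjection x with hp
  -- Only the projection of `x` to the closed range of `L` matters, and it is a rapidly convergent
  -- sum of vectors `L (d n)`.
  have hxp ξ : ⟪x, L ξ⟫_ℂ = ⟪p, L ξ⟫_ℂ := by
    have h1 := Submodule.starProjection_inner_eq_zero (K := R) x (L ξ)
      (L.range.le_topologicalClosure ⟨ξ, rfl⟩)
    rwa [inner_sub_left, sub_eq_zero] at h1
  have hpR : p ∈ closure (L.range.toAddSubgroup : Set M) :=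
    (R.starProjection_apply_mem x : p ∈ R)
  obtain ⟨v, hv, hvR, -, hvn⟩ := controlled_sum_of_mem_closure (s := L.range.toAddSubgroup) hpR
    (b := fun n => (1 / 2 : ℝ) ^ n) (fun n => by positivity)
  choose d hd using hvR
  have hLd : Summable fun n => ‖L (d n)‖ := by
    -- The geometric bound on the terms starts at index 1.
    rw [← summable_nat_add_iff 1]
    refine Summable.of_nonneg_of_le (fun _ => norm_nonneg _) (fun n => ?_)
      ((summable_nat_add_iff 1).mpr summable_geometric_two)
    rw [hd]
    exact (hvn (n + 1) n.succ_pos).le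
  have hsum : HasSum (fun n => L (d n)) p := by
    have h1 := hLd.of_norm.hasSum
    have h2 : p = ∑' n, L (d n) := by
      refine tendsto_nhds_unique hv ?_
      simp_rw [← hd]
      exact h1.tendsto_sum_nat.comp (Filter.tendsto_add_atTop_nat 1)
    rw [h2]; exact h1
  -- The norms `‖d n‖` are not controlled by `‖L (d n)‖`. So `d n` is replaced by `d' n` in the unit
  -- ball and the factor `b n` is moved into the functional: `w(⟨d, ξ⟩) = w(b ⟨d', ξ⟩)`, of norm at
  -- most `‖J b‖ ‖J‖`. Here `‖J b‖² = ‖L d‖² + δ ‖J 1‖²`, and `δ = 4⁻ⁿ` has the summable square root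
  -- `2⁻ⁿ`.
  choose d' b hb hbb hd'1 hip using fun n => exists_factor_unitBall (N := N) (d n)
    (δ := ((1 / 4 : ℝ) ^ n)) (by positivity)
  have hJb n : ‖J (b n)‖ ≤ ‖L (d n)‖ + (1 / 2) ^ n * ‖J 1‖ := by
    have h1 : ((‖J (b n)‖ ^ 2 : ℝ) : ℂ) = ((‖L (d n)‖ ^ 2 + (1 / 4) ^ n * ‖J 1‖ ^ 2 : ℝ) : ℂ) := by
      have h2 := hJ (b n) (b n)
      have h3 := hJ 1 1
      have h4 := hL (d n) (d n)
      rw [inner_self_eq_norm_sq_to_K] at h2 h3 h4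
      rw [hb, hbb, map_add, map_smul] at h2
      rw [star_one, one_mul] at h3
      push_cast
      push_cast at h2 h3 h4
      rw [← h4, ← h3] at h2
      simpa using h2
    have h2 : ‖J (b n)‖ ^ 2 = ‖L (d n)‖ ^ 2 + (1 / 4) ^ n * ‖J 1‖ ^ 2 := by exact_mod_cast h1
    refine le_of_sq_le_sq (h2.trans_le ?_) (by positivity)
    have h5 : ((1 : ℝ) / 4) ^ n = ((1 / 2) ^ n) ^ 2 := by
      rw [← pow_mul, mul_comm, pow_mul]; norm_num
    rw [h5, add_sq, mul_pow]
    have : 0 ≤ 2 * ‖L (d n)‖ * ((1 / 2) ^ n * ‖J 1‖) := by positivity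
    linarith
  have hwn n : ‖w ∘L ContinuousLinearMap.mul ℂ N (b n)‖ ≤
      (‖L (d n)‖ + (1 / 2) ^ n * ‖J 1‖) * ‖J‖ := by
    refine ContinuousLinearMap.opNorm_le_bound _ (by positivity) fun a => ?_
    have : (w ∘L ContinuousLinearMap.mul ℂ N (b n)) a = ⟪J (b n), J a⟫_ℂ := by
      rw [hJ, hb]; rfl
    rw [this]
    calc _ ≤ ‖J (b n)‖ * ‖J a‖ := norm_inner_le_norm _ _
      _ ≤ (‖L (d n)‖ + (1 / 2) ^ n * ‖J 1‖) * (‖J‖ * ‖a‖) := by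
          gcongr
          · exact hJb n
          · exact J.le_opNorm a
      _ = _ := by ring
  have hcont := sigmaTopology_continuous_tsum (fun n => w ∘L ContinuousLinearMap.mul ℂ N (b n)) d'
    (fun n => predual_comp_mul_left hw (b n)) (by
      refine Summable.of_nonneg_of_le (fun _ => by positivity) (fun n => ?_)
        ((hLd.add (summable_geometric_two.mul_right ‖J 1‖)).mul_right ‖J‖)
      calc _ ≤ ((‖L (d n)‖ + (1 / 2) ^ n * ‖J 1‖) * ‖J‖) * 1 := by
            gcongr
            · exact hwn n
            · exact hd'1 n
        _ = _ := mul_one _)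
  convert hcont using 1
  funext ξ
  rw [hxp]
  have h1 : HasSum (fun n => ⟪L (d n), L ξ⟫_ℂ) ⟪p, L ξ⟫_ℂ := by
    have := (hsum.mapL (innerSL ℂ (L ξ))).star
    simpa [Complex.star_def] using this
  rw [← h1.tsum_eq]
  refine tsum_congr fun n => ?_
  rw [hL, hip]
  rfl

end Module

end Normal

/-! ### Normal representations, and isometric maps over them. -/

section NormalRep

variable {H₀ : Type w} [NormedAddCommGroup H₀] [InnerProductSpace ℂ H₀] [CompleteSpace H₀]
  {N : VonNeumannAlgebra H₀}
  {K : Type*} [NormedAddCommGroup K] [InnerProductSpace ℂ K]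

/-- The predual is a norm-closed subspace; a family that is not summable has sum 0 by convention. -/
theorem tsum_mem_predual {ι : Type*} {f : ι → StrongDual ℂ N} (hf : ∀ i, f i ∈ predual N) :
    ∑' i, f i ∈ predual N := by
  have hc := isClosed_predual N
  have h : predual N = ((ballFunctional N).toLinearMap.range : Set (StrongDual ℂ N)) :=
    predual_eq_range N
  rw [h] at hc ⊢
  refine tsum_mem hc fun i => ?_
  have := hf i
  rwa [h] at this

/-- For `y ∈ ℓ²(K)`, the map `ξ ↦ (A(ξ) yₙ)ₙ` into `ℓ²(K)`. -/
def ampVec {X : Type*} [NormedAddCommGroup X] [NormedSpace ℂ X] (A : X →L[ℂ] (K →L[ℂ] K))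
    (y : lp (fun _ : ℕ => K) 2) : X →L[ℂ] lp (fun _ : ℕ => K) 2 :=
  have hb (ξ : X) (n : ℕ) : ‖A ξ (y n)‖ ^ 2 ≤ (‖A‖ * ‖ξ‖) ^ 2 * ‖y n‖ ^ 2 := by
    rw [← mul_pow]
    gcongr
    exact A.le_opNorm₂ ξ (y n)
  have hm (ξ : X) : Memℓp (E := fun _ : ℕ => K) (fun n => A ξ (y n)) 2 := by
    refine memℓp_gen (Summable.of_nonneg_of_le (fun _ => by positivity) (fun n => ?_)
      ((summable_sq_norm_lp y).mul_left ((‖A‖ * ‖ξ‖) ^ 2)))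
    simpa using hb ξ n
  LinearMap.mkContinuous
    { toFun := fun ξ => ⟨_, hm ξ⟩
      map_add' := fun ξ η => by ext n; simp; rfl
      map_smul' := fun c ξ => by ext n; simp } (‖A‖ * ‖y‖) fun ξ => by
    refine le_of_sq_le_sq ?_ (by positivity)
    have h1 (z : lp (fun _ : ℕ => K) 2) : ‖z‖ ^ 2 = ∑' n, ‖z n‖ ^ 2 := by
      simpa using lp.norm_rpow_eq_tsum (p := 2) (by norm_num) z
    have h2 : (‖A‖ * ‖y‖ * ‖ξ‖) ^ 2 = ∑' n, (‖A‖ * ‖ξ‖) ^ 2 * ‖y n‖ ^ 2 := by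
      rw [tsum_mul_left, ← h1]; ring
    rw [h1, h2]
    exact (summable_sq_norm_lp _).tsum_le_tsum (hb ξ) ((summable_sq_norm_lp y).mul_left _)

variable [CompleteSpace K]

theorem norm_rep_le (π : N →⋆ₙₐ[ℂ] (K →L[ℂ] K)) (a : N) : ‖π a‖ ≤ ‖a‖ :=
  NonUnitalStarAlgHom.norm_apply_le π a

/-- A `⋆`-representation of `N` as a continuous linear map. -/
def repL (π : N →⋆ₙₐ[ℂ] (K →L[ℂ] K)) : N →L[ℂ] (K →L[ℂ] K) :=
  LinearMap.mkContinuous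
    { toFun := π, map_add' := map_add π, map_smul' := map_smul π } 1 fun a => by
      simpa using norm_rep_le π a

/-- The functional `a ↦ ⟨x, π(a) y⟩`, as a function of `x` and `y`. -/
def coeffL (π : N →⋆ₙₐ[ℂ] (K →L[ℂ] K)) : K →L⋆[ℂ] K →L[ℂ] StrongDual ℂ N :=
  LinearMap.mkContinuous₂
    (LinearMap.mk₂'ₛₗ (starRingEnd ℂ) (RingHom.id ℂ)
      (fun x y => (innerSL ℂ x) ∘L (ContinuousLinearMap.apply ℂ K y) ∘L repL π)
      (fun x x' y => by ext a; simp)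
      (fun k x y => by ext a; simp)
      (fun x y y' => by ext a; simp)
      (fun k x y => by ext a; simp)) 1 (fun x y => by
    refine ContinuousLinearMap.opNorm_le_bound _ (by positivity) fun a => ?_
    change ‖⟪x, π a y⟫_ℂ‖ ≤ _
    calc _ ≤ ‖x‖ * (‖π a‖ * ‖y‖) := (norm_inner_le_norm _ _).trans (by
          gcongr; exact ContinuousLinearMap.le_opNorm _ _)
      _ ≤ ‖x‖ * (‖a‖ * ‖y‖) := by gcongr; exact norm_rep_le π a
      _ = _ := by ring)

@[simp] theorem coeffL_apply (π : N →⋆ₙₐ[ℂ] (K →L[ℂ] K)) (x y : K) (a : N) :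
    coeffL π x y a = ⟪x, π a y⟫_ℂ := rfl

theorem norm_coeffL_le (π : N →⋆ₙₐ[ℂ] (K →L[ℂ] K)) (x y : K) :
    ‖coeffL π x y‖ ≤ ‖x‖ * ‖y‖ := by
  refine ContinuousLinearMap.opNorm_le_bound _ (by positivity) fun a => ?_
  rw [coeffL_apply]
  calc _ ≤ ‖x‖ * (‖π a‖ * ‖y‖) := (norm_inner_le_norm _ _).trans (by
        gcongr; exact ContinuousLinearMap.le_opNorm _ _)
    _ ≤ ‖x‖ * (‖a‖ * ‖y‖) := by gcongr; exact norm_rep_le π a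
    _ = _ := by ring

/-- Normality: the coefficient functionals are in the predual. -/
def IsNormalRep (π : N →⋆ₙₐ[ℂ] (K →L[ℂ] K)) : Prop :=
  ∀ x y : K, coeffL π x y ∈ predual N

theorem isNormalRep_of_continuous {π : N →⋆ₙₐ[ℂ] (K →L[ℂ] K)}
    (h : Continuous[sigmaWeakOn N, sigmaWeak K] π) : IsNormalRep π := by
  intro x y
  classical
  have h1 := @Continuous.comp _ _ _ (sigmaWeakOn N) (sigmaWeak K) _ _ _
    (sigmaWeak_continuous_tsum (lp.single 2 0 x) (lp.single 2 0 y)) h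
  change Continuous[sigmaWeakOn N, inferInstance] _
  convert h1 using 1
  funext a
  rw [Function.comp, tsum_eq_single 0]
  · simp
  · intro n hn
    simp [hn]

theorem tsum_coeffL_mem_predual {π : N →⋆ₙₐ[ℂ] (K →L[ℂ] K)} (h : IsNormalRep π)
    (x y : lp (fun _ : ℕ => K) 2) :
    ∃ w ∈ predual N, ∀ a, w a = ∑' n, ⟪x n, π a (y n)⟫_ℂ := by
  refine ⟨∑' n, coeffL π (x n) (y n), tsum_mem_predual fun n => h _ _, fun a => ?_⟩
  have hs : Summable fun n => coeffL π (x n) (y n) :=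
    Summable.of_norm_bounded (summable_norm_mul_norm_lp x y) fun n => norm_coeffL_le π _ _
  exact (ContinuousLinearMap.apply ℂ ℂ a).map_tsum hs

/-- Normality may be tested on a total set of vectors. -/
theorem isNormalRep_of_dense {π : N →⋆ₙₐ[ℂ] (K →L[ℂ] K)} (D : Set K)
    (hD : (Submodule.span ℂ D).topologicalClosure = ⊤)
    (h : ∀ x ∈ D, ∀ y ∈ D, coeffL π x y ∈ predual N) : IsNormalRep π := by
  let R : Submodule ℂ (StrongDual ℂ N) := (ballFunctional N).toLinearMap.range
  have hR : predual N = (R : Set (StrongDual ℂ N)) := predual_eq_range N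
  have hRc : IsClosed (R : Set (StrongDual ℂ N)) := hR ▸ isClosed_predual N
  -- The closed predual pulls back to a closed subspace under the coefficient map, in one variable
  -- at a time.
  have h1 : ∀ x ∈ D, ∀ y, coeffL π x y ∈ R := by
    intro x hx
    have h2 : (Submodule.span ℂ D).topologicalClosure ≤ R.comap (coeffL π x).toLinearMap := by
      refine Submodule.topologicalClosure_minimal _ (Submodule.span_le.mpr fun y hy => ?_)
        (hRc.preimage (coeffL π x).continuous)
      have := h x hx y hy
      rwa [hR] at this
    rw [hD] at h2
    exact fun y => h2 (Submodule.mem_top (x := y))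
  intro x y
  rw [hR]
  have h2 : (Submodule.span ℂ D).topologicalClosure ≤ R.comap ((coeffL π).flip y).toLinearMap := by
    refine Submodule.topologicalClosure_minimal _ (Submodule.span_le.mpr fun x hx => ?_)
      (hRc.preimage ((coeffL π).flip y).continuous)
    exact h1 x hx y
  rw [hD] at h2
  exact h2 (Submodule.mem_top (x := x))

section Module

variable {E : Type u} [NormedAddCommGroup E] [NormedSpace ℂ E] [CompleteSpace E]
  [Module (↥N)ᵐᵒᵖ E] [HilbertModule N E] {π : N →⋆ₙₐ[ℂ] (K →L[ℂ] K)}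
  {A : E →ₗ[ℂ] (K →L[ℂ] K)}

theorem norm_le_of_isometric (hA : ∀ ξ η, star (A ξ) * A η = π (ip N ξ η)) (ξ : E) :
    ‖A ξ‖ ≤ ‖ξ‖ := by
  refine le_of_sq_le_sq ?_ (norm_nonneg _)
  rw [HilbertModule.norm_sq (N := N) ξ, sq, ← CStarRing.norm_star_mul_self, hA]
  exact norm_rep_le π _

/-- An isometric map over a normal representation is continuous from the `σ`-topology to the
σ-weak topology. -/
theorem sigmaTopology_continuous_of_isometric (hπ : IsNormalRep π)
    (hA : ∀ ξ η, star (A ξ) * A η = π (ip N ξ η)) :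
    Continuous[sigmaTopology N E, sigmaWeak K] A := by
  rw [continuous_iInf_rng]
  intro x
  rw [continuous_iInf_rng]
  intro y
  rw [continuous_induced_rng]
  let A' : E →L[ℂ] (K →L[ℂ] K) := A.mkContinuous 1 fun ξ => by
    simpa using norm_le_of_isometric hA ξ
  obtain ⟨w, hw, hwa⟩ := tsum_coeffL_mem_predual hπ y y
  -- After amplification to `ℓ²(K)` a σ-weak functional is the single inner product of `x` with
  -- `(A(ξ) yₙ)ₙ`. The normal functional is `w = ∑ ⟨yₙ, π(·) yₙ⟩`, with GNS map `a ↦ (π(a) yₙ)ₙ`.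
  have h := sigmaTopology_continuous_inner (ampVec A' y).toLinearMap (ampVec (repL π) y) w hw
    (fun ξ η => by
      rw [hwa, lp.inner_eq_tsum]
      refine tsum_congr fun n => ?_
      change ⟪A ξ (y n), A η (y n)⟫_ℂ = _
      rw [← hA, ContinuousLinearMap.star_eq_adjoint, mul_apply_eq_comp,
        ContinuousLinearMap.adjoint_inner_right])
    (fun a b => by
      rw [hwa, lp.inner_eq_tsum]
      refine tsum_congr fun n => ?_
      change ⟪π a (y n), π b (y n)⟫_ℂ = _
      rw [map_mul, map_star, ContinuousLinearMap.star_eq_adjoint, mul_apply_eq_comp,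
        ContinuousLinearMap.adjoint_inner_right]) x
  convert h using 1
  funext ξ
  exact (lp.inner_eq_tsum x (ampVec A' y ξ)).symm

/-- The matrix `[A ξᵢⱼ]⋆ [A ξᵢⱼ]` is the entrywise image under `π` of the Gram matrix, and entrywise
application of a `⋆`-homomorphism is a `⋆`-homomorphism of C⋆-algebras, hence contractive. -/
theorem isCompletelyContractive_of_isometric
    (hA : ∀ ξ η, star (A ξ) * A η = π (ip N ξ η)) : IsCompletelyContractive N A := by
  let _ : PartialOrder N := CStarAlgebra.spectralOrder N
  have _ : StarOrderedRing N := CStarAlgebra.spectralOrderedRing N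
  intro n ξ
  set Y : CStarMatrix (Fin n) (Fin n) N :=
    CStarMatrix.ofMatrix (Matrix.of fun i j => ∑ k, ip N (ξ k i) (ξ k j))
  have h1 : star (CStarMatrix.ofMatrix (Matrix.of fun i j => A (ξ i j))) *
      CStarMatrix.ofMatrix (Matrix.of fun i j => A (ξ i j)) = CStarMatrix.mapₙₐ π Y := by
    ext1 i j
    simp only [CStarMatrix.mul_apply, CStarMatrix.star_apply, CStarMatrix.ofMatrix_apply,
      Matrix.of_apply, hA, Y]
    exact (map_sum π _ _).symm
  rw [sq, ← CStarRing.norm_star_mul_self, h1]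
  refine (NonUnitalStarAlgHom.norm_apply_le _ _).trans (le_of_eq ?_)
  -- The norm in the definition is that of matrices over `B(H₀)`; the inclusion of `N` is injective
  -- on matrices, so it is isometric.
  let ι : N →⋆ₙₐ[ℂ] (H₀ →L[ℂ] H₀) := (N.toStarSubalgebra.subtype : N →⋆ₙₐ[ℂ] (H₀ →L[ℂ] H₀))
  refine (NonUnitalStarAlgHom.norm_map (CStarMatrix.mapₙₐ ι) ?_ Y).symm
  intro P Q h
  ext1 i j
  exact Subtype.ext (congrArg (fun Z => Z i j) h)

end Module

section ProductSystem

variable {E : ℝ≥0 → Type u}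
  [∀ t, NormedAddCommGroup (E t)] [∀ t, NormedSpace ℂ (E t)] [∀ t, CompleteSpace (E t)]
  [∀ t, Module (↥N)ᵐᵒᵖ (E t)] [∀ t, WStarCorrespondence N (E t)]
  {P : DiscreteProductSystem N E}

/-- Under `N ≃ E 0` a functional `f(⟨η, ·⟩)` becomes `f(c⋆ ·)`, which is normal, and the series of
these converges in the norm-closed predual. This yields normality of `T_0`. -/
theorem sigmaTopology_continuous_unit (P : DiscreteProductSystem N E) :
    Continuous[sigmaWeakOn N, sigmaTopology N (E 0)] P.unit := by
  simp only [continuous_iInf_rng]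
  intro f η hf hs
  rw [continuous_induced_rng]
  obtain ⟨c, rfl⟩ : ∃ c : ℕ → N, η = fun n => P.unit (c n) :=
    ⟨fun n => P.unit.symm (η n), by simp⟩
  have hn (a : N) : ‖P.unit a‖ = ‖a‖ := by
    rw [← sq_eq_sq₀ (norm_nonneg _) (norm_nonneg _), HilbertModule.norm_sq (N := N), ← ip,
      P.ip_unit, sq, CStarRing.norm_star_mul_self]
  have h := tsum_mem_predual fun n => predual_comp_mul_left (hf n) (star (c n))
  convert (show Continuous[sigmaWeakOn N, inferInstance] _ from h) using 1
  funext a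
  have hs' : Summable fun n => f n ∘L ContinuousLinearMap.mul ℂ N (star (c n)) := by
    refine Summable.of_norm_bounded hs fun n => ?_
    refine ContinuousLinearMap.opNorm_le_bound _ (by positivity) fun a => ?_
    calc _ ≤ ‖f n‖ * (‖star (c n)‖ * ‖a‖) := ((f n).le_opNorm _).trans (by
          gcongr; exact norm_mul_le _ _)
      _ = _ := by rw [norm_star, hn, mul_assoc]
  refine Eq.trans ?_ ((ContinuousLinearMap.apply ℂ ℂ a).map_tsum hs').symm
  refine tsum_congr fun n => ?_
  rw [P.ip_unit]
  rfl

theorem CovariantRep.isNormalRep_rep (T : CovariantRep P K) : IsNormalRep T.rep := by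
  refine isNormalRep_of_continuous ?_
  have := @Continuous.comp _ _ _ (sigmaWeakOn N) (sigmaTopology N (E 0)) (sigmaWeak K) _ _
    (T.continuous 0) (sigmaTopology_continuous_unit P)
  convert this using 1
  funext a
  exact (T.T_unit a).symm

end ProductSystem

end NormalRep

/-! ### Left action and creation operators on `E ⊗_σ H`. -/

section Tensor

variable {H₀ : Type w} [NormedAddCommGroup H₀] [InnerProductSpace ℂ H₀] [CompleteSpace H₀]
  {N : VonNeumannAlgebra H₀}
  {H : Type v} [NormedAddCommGroup H] [InnerProductSpace ℂ H] [CompleteSpace H]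
  (σ : N →⋆ₙₐ[ℂ] (H →L[ℂ] H))

section Module

variable {E : Type u} [NormedAddCommGroup E] [NormedSpace ℂ E] [CompleteSpace E]
  [Module (↥N)ᵐᵒᵖ E] [HilbertModule N E]

/-- The canonical map from the algebraic tensor product to `E ⊗_σ H`. -/
def toTensor : E ⊗[ℂ] H →ₗ[ℂ] InteriorTensor E σ :=
  (UniformSpace.Completion.toComplₗᵢ (𝕜 := ℂ) (E := PreTensor E σ)).toLinearMap ∘ₗ
    (LinearMap.id : E ⊗[ℂ] H →ₗ[ℂ] PreTensor E σ)

@[simp] theorem toTensor_tmul (ξ : E) (h : H) : toTensor σ (ξ ⊗ₜ h) = tensorVec σ ξ h := rfl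

theorem inner_toTensor (x y : E ⊗[ℂ] H) :
    ⟪toTensor σ x, toTensor σ y⟫_ℂ = tensorForm σ x y :=
  UniformSpace.Completion.inner_coe (𝕜 := ℂ) (E := PreTensor E σ) x y

theorem norm_sq_toTensor (x : E ⊗[ℂ] H) :
    ‖toTensor σ x‖ ^ 2 = RCLike.re (tensorForm σ x x) := by
  rw [← inner_toTensor]
  exact norm_sq_eq_re_inner (𝕜 := ℂ) _

theorem denseRange_toTensor : DenseRange (toTensor (E := E) σ) :=
  UniformSpace.Completion.denseRange_coe (α := PreTensor E σ)

theorem topologicalClosure_span_tensorVec :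
    (Submodule.span ℂ (Set.range fun p : E × H => tensorVec σ p.1 p.2)).topologicalClosure = ⊤ := by
  rw [← Submodule.dense_iff_topologicalClosure_eq_top]
  refine (denseRange_toTensor (E := E) σ).mono ?_
  rintro _ ⟨x, rfl⟩
  induction x using TensorProduct.induction_on with
  | zero => simp
  | tmul ξ k => exact Submodule.subset_span ⟨(ξ, k), rfl⟩
  | add x y hx hy => rw [map_add]; exact Submodule.add_mem _ hx hy

theorem tensor_ext {M : Type*} [NormedAddCommGroup M] [NormedSpace ℂ M]
    {f g : InteriorTensor E σ →L[ℂ] M}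
    (h : ∀ ξ k, f (tensorVec σ ξ k) = g (tensorVec σ ξ k)) : f = g := by
  refine ContinuousLinearMap.ext fun x => ?_
  refine (denseRange_toTensor (E := E) σ).induction_on x (isClosed_eq f.continuous g.continuous)
    fun y => ?_
  induction y using TensorProduct.induction_on with
  | zero => simp
  | tmul ξ k => exact h ξ k
  | add x y hx hy => rw [map_add, map_add, map_add, hx, hy]

theorem tensor_inner_ext {y z : InteriorTensor E σ}
    (h : ∀ ξ k, ⟪tensorVec σ ξ k, y⟫_ℂ = ⟪tensorVec σ ξ k, z⟫_ℂ) : y = z := by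
  have h1 : innerSL ℂ y = innerSL ℂ z := tensor_ext σ fun ξ k => by
    simpa using congrArg (starRingEnd ℂ) (h ξ k)
  refine ext_inner_right ℂ fun x => ?_
  simpa using congrArg (fun f => f x) h1

variable {F : Type*} [NormedAddCommGroup F] [NormedSpace ℂ F] [CompleteSpace F]
  [Module (↥N)ᵐᵒᵖ F] [HilbertModule N F]
variable {G : Type*} [NormedAddCommGroup G] [NormedSpace ℂ G] [CompleteSpace G]
  [Module (↥N)ᵐᵒᵖ G] [HilbertModule N G]

/-- Source of the norm estimates: `B` is the left action of `a⋆ a` when `A = A'` is that of `a`, and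
of `⟨ξ, ξ⟩` when `A = A'` is creation by `ξ`. -/
theorem tensorForm_rTensor (A : F →ₗ[ℂ] G) (A' : F →ₗ[ℂ] G) (B : F →ₗ[ℂ] F)
    (h : ∀ η ζ, ip N (A η) (A' ζ) = ip N η (B ζ)) (x y : F ⊗[ℂ] H) :
    tensorForm σ (A.rTensor H x) (A'.rTensor H y) = tensorForm σ x (B.rTensor H y) := by
  induction x using TensorProduct.induction_on with
  | zero => simp
  | add x₁ x₂ h₁ h₂ => simp [h₁, h₂]
  | tmul ξ k =>
    induction y using TensorProduct.induction_on with
    | zero => simp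
    | add y₁ y₂ h₁ h₂ => simp only [map_add, h₁, h₂]
    | tmul η l => simp [h]

end Module

section Correspondence

variable {F : Type u} [NormedAddCommGroup F] [NormedSpace ℂ F] [CompleteSpace F]
  [Module (↥N)ᵐᵒᵖ F] [WStarCorrespondence N F]

theorem ip_lact_lact (a b : N) (ξ η : F) :
    ip N (lact N a ξ) (lact N b η) = ip N ξ (lact N (star a * b) η) := by
  simp only [ip, lact]
  rw [WStarCorrespondence.left_adjoint, map_mul]
  rfl

/-- The left action of `N` as linear maps. -/
abbrev leftL (a : N) : F →ₗ[ℂ] F := (WStarCorrespondence.left (N := N) (E := F) a).toLinearMap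

theorem exists_star_mul_self_add_eq {A : Type*} [CStarAlgebra A] (a : A) :
    ∃ c : A, star a * a + star c * c = ((‖a‖ ^ 2 : ℝ) : ℂ) • (1 : A) := by
  let _ : PartialOrder A := CStarAlgebra.spectralOrder A
  have _ : StarOrderedRing A := CStarAlgebra.spectralOrderedRing A
  obtain ⟨c, hc⟩ := CStarAlgebra.nonneg_iff_eq_star_mul_self.mp
    (sub_nonneg.mpr (CStarAlgebra.star_mul_le_algebraMap_norm_sq (a := a)))
  refine ⟨c, ?_⟩
  rw [← hc, ← Algebra.algebraMap_eq_smul_one, add_sub_cancel,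
    IsScalarTower.algebraMap_apply ℝ ℂ A]
  rfl

/-- With `a⋆a + c⋆c = ‖a‖² 1` one gets `‖a x‖² + ‖c x‖² = ‖a‖² ‖1 x‖²`. The left action need not be
unital, so `‖1 x‖ ≤ ‖x‖` is obtained separately from `‖1 x‖² = Re ⟨x, 1 x⟩` and Cauchy–Schwarz. -/
theorem norm_toTensor_leftL_le (a : N) (x : F ⊗[ℂ] H) :
    ‖toTensor σ ((leftL (F := F) a).rTensor H x)‖ ≤ ‖a‖ * ‖toTensor σ x‖ := by
  have hq (c : N) : ‖toTensor σ ((leftL (F := F) c).rTensor H x)‖ ^ 2 =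
      RCLike.re (tensorForm σ x ((leftL (F := F) (star c * c)).rTensor H x)) := by
    rw [norm_sq_toTensor, tensorForm_rTensor σ _ _ (leftL (star c * c))]
    exact fun η ζ => ip_lact_lact c c η ζ
  have h1 : ‖toTensor σ ((leftL (F := F) (1 : N)).rTensor H x)‖ ≤ ‖toTensor σ x‖ := by
    have h2 := hq 1
    rw [star_one, one_mul, ← inner_toTensor, sq] at h2
    have h3 := (RCLike.re_le_norm _).trans (norm_inner_le_norm (𝕜 := ℂ) (toTensor σ x)
      (toTensor σ ((leftL (F := F) (1 : N)).rTensor H x)))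
    rw [← h2] at h3
    rcases (norm_nonneg (toTensor σ ((leftL (F := F) (1 : N)).rTensor H x))).eq_or_lt with h4 | h4
    · rw [← h4]; exact norm_nonneg _
    · exact le_of_mul_le_mul_right h3 h4
  obtain ⟨c, h5⟩ := exists_star_mul_self_add_eq a
  have h6 := hq 1
  rw [star_one, one_mul] at h6
  have h7 : ‖toTensor σ ((leftL (F := F) a).rTensor H x)‖ ^ 2 +
      ‖toTensor σ ((leftL (F := F) c).rTensor H x)‖ ^ 2 =
      ‖a‖ ^ 2 * ‖toTensor σ ((leftL (F := F) (1 : N)).rTensor H x)‖ ^ 2 := by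
    rw [hq a, hq c, h6, ← map_add, ← map_add, ← LinearMap.add_apply, ← LinearMap.rTensor_add]
    have : leftL (F := F) (star a * a) + leftL (star c * c) =
        ((‖a‖ ^ 2 : ℝ) : ℂ) • leftL (F := F) (1 : N) := by
      ext ξ
      have := congrArg (fun b : N => WStarCorrespondence.left (N := N) (E := F) b ξ) h5
      rw [map_add, map_smul] at this
      exact this
    rw [this, LinearMap.rTensor_smul, LinearMap.smul_apply, map_smul, smul_eq_mul]
    exact RCLike.re_ofReal_mul _ _
  refine le_of_sq_le_sq ?_ (by positivity)
  rw [mul_pow]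
  calc _ ≤ ‖a‖ ^ 2 * ‖toTensor σ ((leftL (F := F) (1 : N)).rTensor H x)‖ ^ 2 := by
        rw [← h7]; exact le_add_of_nonneg_right (by positivity)
    _ ≤ _ := by gcongr

theorem exists_leftRep (a : N) : ∃ S : InteriorTensor F σ →L[ℂ] InteriorTensor F σ,
    ∀ η h, S (tensorVec σ η h) = tensorVec σ (lact N a η) h := by
  refine ⟨(toTensor σ ∘ₗ (leftL (F := F) a).rTensor H).extendOfNorm (toTensor σ), fun η h => ?_⟩
  exact LinearMap.extendOfNorm_eq (denseRange_toTensor σ)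
    ⟨‖a‖, fun x => norm_toTensor_leftL_le σ a x⟩ (η ⊗ₜ h)

theorem tensorVec_add (ξ η : F) (h : H) :
    tensorVec σ (ξ + η) h = tensorVec σ ξ h + tensorVec σ η h := by
  simp only [← toTensor_tmul, TensorProduct.add_tmul, map_add]

theorem tensorVec_smul (c : ℂ) (ξ : F) (h : H) :
    tensorVec σ (c • ξ) h = c • tensorVec σ ξ h := by
  simp only [← toTensor_tmul, ← TensorProduct.smul_tmul', map_smul]

variable (F) in
/-- The representation of `N` on `F ⊗_σ H` by the left action on `F`. -/
def leftRep : N →⋆ₙₐ[ℂ] (InteriorTensor F σ →L[ℂ] InteriorTensor F σ) :=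
  have hS (a : N) := Classical.choose_spec (exists_leftRep (F := F) σ a)
  { toFun := fun a => Classical.choose (exists_leftRep (F := F) σ a)
    map_smul' := fun c a => tensor_ext σ fun ξ k => by
      simp only [hS, MonoidHom.id_apply, smul_apply, ← tensorVec_smul]
      simp [lact]
    map_zero' := tensor_ext σ fun ξ k => by
      rw [hS, zero_apply, ← zero_smul ℂ (tensorVec σ ξ k), ← tensorVec_smul]
      simp [lact]
    map_add' := fun a b => tensor_ext σ fun ξ k => by
      simp only [hS, add_apply, ← tensorVec_add]
      simp [lact]
    map_mul' := fun a b => tensor_ext σ fun ξ k => by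
      rw [mul_apply_eq_comp]
      simp only [hS]
      simp [lact]
    map_star' := fun a => by
      rw [ContinuousLinearMap.star_eq_adjoint]
      refine tensor_ext (E := F) σ fun ξ k => tensor_inner_ext σ fun η l => ?_
      rw [ContinuousLinearMap.adjoint_inner_right]
      simp only [hS, inner_tensorVec, lact, ip]
      rw [WStarCorrespondence.left_adjoint] }

@[simp] theorem leftRep_tensorVec (a : N) (η : F) (h : H) :
    leftRep σ F a (tensorVec σ η h) = tensorVec σ (lact N a η) h :=
  Classical.choose_spec (exists_leftRep (F := F) σ a) η h

/-- On the total set of elementary tensors the coefficient is `a ↦ ⟨h, σ(⟨ξ, a η⟩) k⟩`, a composite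
of two normal maps. -/
theorem isNormalRep_leftRep (hσ : IsNormalRep σ) : IsNormalRep (leftRep σ F) := by
  refine isNormalRep_of_dense _ (topologicalClosure_span_tensorVec σ) ?_
  rintro _ ⟨⟨ξ, h⟩, rfl⟩ _ ⟨⟨η, k⟩, rfl⟩
  have := @Continuous.comp _ _ _ (sigmaWeakOn N) (sigmaWeakOn N) _ _ _ (hσ h k)
    (WStarCorrespondence.left_normal ξ η)
  change Continuous[sigmaWeakOn N, inferInstance] _
  convert this using 1
  funext a
  simp only [coeffL_apply, leftRep_tensorVec, inner_tensorVec, Function.comp]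

variable {E G : Type u} [NormedAddCommGroup E] [NormedSpace ℂ E] [CompleteSpace E]
  [Module (↥N)ᵐᵒᵖ E] [WStarCorrespondence N E]
  [NormedAddCommGroup G] [NormedSpace ℂ G] [CompleteSpace G] [Module (↥N)ᵐᵒᵖ G]
  [WStarCorrespondence N G] {m : E →ₗ[ℂ] F →ₗ[ℂ] G}

theorem exists_creation (hm : IsTensorIso N m) (ξ : E) :
    ∃ S : InteriorTensor F σ →L[ℂ] InteriorTensor G σ,
      ∀ η h, S (tensorVec σ η h) = tensorVec σ (m ξ η) h := by
  refine ⟨(toTensor σ ∘ₗ (m ξ).rTensor H).extendOfNorm (toTensor σ), fun η h => ?_⟩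
  refine LinearMap.extendOfNorm_eq (denseRange_toTensor σ) ⟨‖ξ‖, fun x => ?_⟩ (η ⊗ₜ h)
  refine le_of_sq_le_sq ?_ (by positivity)
  rw [LinearMap.comp_apply, norm_sq_toTensor,
    tensorForm_rTensor σ _ _ (leftL (ip N ξ ξ)) (fun η ζ => hm.ip_eq ξ η ξ ζ), ← inner_toTensor]
  refine (RCLike.re_le_norm _).trans <| (norm_inner_le_norm _ _).trans ?_
  calc _ ≤ ‖toTensor σ x‖ * (‖ip N ξ ξ‖ * ‖toTensor σ x‖) := by
        gcongr; exact norm_toTensor_leftL_le σ _ x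
    _ = _ := by rw [ip, ← HilbertModule.norm_sq]; ring

/-- The creation operators `F ⊗_σ H → G ⊗_σ H`, `η ⊗ h ↦ ξη ⊗ h`, for `ξ ∈ E`. -/
def creation (hm : IsTensorIso N m) : E →ₗ[ℂ] (InteriorTensor F σ →L[ℂ] InteriorTensor G σ) :=
  have hS (ξ : E) := Classical.choose_spec (exists_creation σ hm ξ)
  { toFun := fun ξ => Classical.choose (exists_creation σ hm ξ)
    map_add' := fun ξ η => tensor_ext σ fun ζ k => by
      rw [add_apply, hS, hS, hS, ← tensorVec_add, map_add, LinearMap.add_apply]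
    map_smul' := fun c ξ => tensor_ext σ fun ζ k => by
      rw [RingHom.id_apply, smul_apply, hS, hS, ← tensorVec_smul, map_smul,
        LinearMap.smul_apply] }

@[simp] theorem creation_tensorVec (hm : IsTensorIso N m) (ξ : E) (η : F) (h : H) :
    creation σ hm ξ (tensorVec σ η h) = tensorVec σ (m ξ η) h :=
  Classical.choose_spec (exists_creation σ hm ξ) η h

theorem adjoint_creation_comp_creation (hm : IsTensorIso N m) (ξ ξ' : E) :
    (creation σ hm ξ).adjoint ∘L creation σ hm ξ' = leftRep σ F (ip N ξ ξ') := by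
  refine tensor_ext σ fun η k => tensor_inner_ext σ fun ζ l => ?_
  rw [ContinuousLinearMap.comp_apply, ContinuousLinearMap.adjoint_inner_right]
  simp [inner_tensorVec, hm.ip_eq]

theorem inner_creation_creation (hm : IsTensorIso N m) (ξ ξ' : E) (x y : InteriorTensor F σ) :
    ⟪creation σ hm ξ x, creation σ hm ξ' y⟫_ℂ = ⟪x, leftRep σ F (ip N ξ ξ') y⟫_ℂ := by
  rw [← adjoint_creation_comp_creation σ hm, ContinuousLinearMap.comp_apply,
    ContinuousLinearMap.adjoint_inner_right]

/-- If `σ` is normal, the `σ`-density of the range of `m` makes the vectors `ξη ⊗ h` total. -/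
theorem topologicalClosure_span_creation (hm : IsTensorIso N m) (hσ : IsNormalRep σ) :
    (Submodule.span ℂ (Set.range fun p : E × InteriorTensor F σ =>
      creation σ hm p.1 p.2)).topologicalClosure = ⊤ := by
  set R := (Submodule.span ℂ (Set.range fun p : E × InteriorTensor F σ =>
      creation σ hm p.1 p.2)).topologicalClosure with hR
  rw [eq_top_iff, ← topologicalClosure_span_tensorVec (E := G) σ]
  refine Submodule.topologicalClosure_minimal _ (Submodule.span_le.mpr ?_)
    (Submodule.isClosed_topologicalClosure _)
  rintro _ ⟨⟨g, h⟩, rfl⟩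
  have : CompleteSpace R := (Submodule.isClosed_topologicalClosure _).completeSpace_coe
  -- The functional `g' ↦ ⟨p, g' ⊗ h⟩` is `σ`-continuous and vanishes on products `ξη`, hence
  -- everywhere. At `g' = g` its value is `‖p‖²`.
  set p := tensorVec σ g h - R.starProjection (tensorVec σ g h) with hp
  have hpR : ∀ y ∈ R, ⟪p, y⟫_ℂ = 0 := fun y hy => R.starProjection_inner_eq_zero _ y hy
  let L : G →ₗ[ℂ] InteriorTensor G σ :=
    { toFun := fun g => tensorVec σ g h
      map_add' := fun a b => tensorVec_add σ a b h
      map_smul' := fun c a => tensorVec_smul σ c a h }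
  have hcont := sigmaTopology_continuous_inner L
    ((ContinuousLinearMap.apply ℂ H h) ∘L repL σ) (coeffL σ h h) (hσ h h)
    (fun ξ η => inner_tensorVec σ ξ η h h)
    (fun a b => by
      change ⟪σ a h, σ b h⟫_ℂ = ⟪h, σ (star a * b) h⟫_ℂ
      rw [map_mul, map_star, ContinuousLinearMap.star_eq_adjoint, mul_apply_eq_comp,
        ContinuousLinearMap.adjoint_inner_right]) p
  have hz : ∀ g' : G, ⟪p, L g'⟫_ℂ = 0 := by
    have hsub : closure[sigmaTopology N G] ((TensorProduct.lift m).range : Set G) ⊆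
        {g' | ⟪p, L g'⟫_ℂ = 0} := by
      refine @closure_minimal _ (sigmaTopology N G) _ _ ?_ ?_
      · rintro _ ⟨x, rfl⟩
        induction x using TensorProduct.induction_on with
        | zero => simp
        | tmul ξ η =>
          refine hpR _ (Submodule.le_topologicalClosure _ (Submodule.subset_span ?_))
          exact ⟨(ξ, tensorVec σ η h), creation_tensorVec σ hm ξ η h⟩
        | add x y hx hy =>
          change ⟪p, L _⟫_ℂ = 0
          rw [map_add, map_add, inner_add_right]
          rw [show ⟪p, L _⟫_ℂ = 0 from hx, show ⟪p, L _⟫_ℂ = 0 from hy, add_zero]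
      · exact @IsClosed.preimage _ _ (sigmaTopology N G) _ _ hcont _ isClosed_singleton
    rw [hm.dense] at hsub
    exact fun g' => hsub (Set.mem_univ g')
  have hp0 : p = 0 := by
    rw [← inner_self_eq_zero (𝕜 := ℂ)]
    nth_rw 2 [hp]
    rw [inner_sub_right, hpR _ (R.starProjection_apply_mem _), sub_zero]
    exact hz g
  rw [sub_eq_zero] at hp0
  change tensorVec σ g h ∈ R
  rw [hp0]
  exact R.starProjection_apply_mem _

end Correspondence

end Tensor

/-! ### Inductive limits of Hilbert spaces along isometries. -/

section Limit

open Filter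

variable {I : Type*} [Preorder I] {X : I → Type w}
  [∀ i, NormedAddCommGroup (X i)] [∀ i, InnerProductSpace ℂ (X i)]
  (U : ∀ i j, i ≤ j → X i →ₗᵢ[ℂ] X j)

/-- The families that are eventually compatible with the isometries `U`. -/
def preLimitSubmodule [IsDirectedOrder I] [Nonempty I] : Submodule ℂ (∀ i, X i) where
  carrier := {x | ∃ i, ∀ j k (_ : i ≤ j) (h : j ≤ k), U j k h (x j) = x k}
  add_mem' := by
    rintro x y ⟨i, hi⟩ ⟨j, hj⟩
    obtain ⟨k, hik, hjk⟩ := exists_ge_ge i j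
    exact ⟨k, fun l m hl h => by
      rw [Pi.add_apply, Pi.add_apply, map_add, hi _ _ (hik.trans hl), hj _ _ (hjk.trans hl)]⟩
  zero_mem' := ⟨Classical.arbitrary I, fun _ _ _ _ => by simp⟩
  smul_mem' := by
    rintro c x ⟨i, hi⟩
    exact ⟨i, fun l m hl h => by rw [Pi.smul_apply, Pi.smul_apply, map_smul, hi _ _ hl]⟩

variable [IsDirectedOrder I] [Nonempty I]

/-- The eventually compatible families, to be given the inner product of the inductive limit. -/
def PreLimit : Type _ := preLimitSubmodule U

instance : AddCommGroup (PreLimit U) := inferInstanceAs (AddCommGroup (preLimitSubmodule U))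
instance : Module ℂ (PreLimit U) := inferInstanceAs (Module ℂ (preLimitSubmodule U))

variable {U}

theorem PreLimit.eventually_inner_eq (x y : PreLimit U) : ∃ i, ∀ j, i ≤ j →
    ⟪x.1 j, y.1 j⟫_ℂ = ⟪x.1 i, y.1 i⟫_ℂ := by
  obtain ⟨i, hi⟩ := x.2
  obtain ⟨j, hj⟩ := y.2
  obtain ⟨k, hik, hjk⟩ := exists_ge_ge i j
  refine ⟨k, fun l hl => ?_⟩
  rw [← hi k l hik hl, ← hj k l hjk hl, LinearIsometry.inner_map_map]

theorem PreLimit.tendsto_inner (x y : PreLimit U) :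
    Tendsto (fun i => ⟪x.1 i, y.1 i⟫_ℂ) atTop (𝓝 (limUnder atTop fun i => ⟪x.1 i, y.1 i⟫_ℂ)) := by
  obtain ⟨i, hi⟩ := x.eventually_inner_eq y
  refine tendsto_nhds_limUnder ⟨⟪x.1 i, y.1 i⟫_ℂ, ?_⟩
  exact tendsto_const_nhds.congr' (eventually_atTop.mpr ⟨i, fun j hj => (hi j hj).symm⟩)

variable (U) in
/-- The positive semidefinite inner product on the eventually compatible families. -/
abbrev preLimitCore : PreInnerProductSpace.Core ℂ (PreLimit U) where
  inner x y := limUnder atTop fun i => ⟪x.1 i, y.1 i⟫_ℂ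
  conj_inner_symm x y := by
    refine tendsto_nhds_unique (((Complex.continuous_conj.tendsto _).comp (y.tendsto_inner x)))
      ((x.tendsto_inner y).congr fun i => ?_)
    exact (inner_conj_symm _ _).symm
  re_inner_nonneg x :=
    ge_of_tendsto' ((Complex.continuous_re.tendsto _).comp (x.tendsto_inner x)) fun i =>
      inner_self_nonneg (𝕜 := ℂ)
  add_left x y z := by
    refine tendsto_nhds_unique ((x + y).tendsto_inner z)
      (((x.tendsto_inner z).add (y.tendsto_inner z)).congr fun i => ?_)
    exact (inner_add_left _ _ _).symm
  smul_left x y c := by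
    refine tendsto_nhds_unique ((c • x).tendsto_inner y)
      (((x.tendsto_inner y).const_mul _).congr fun i => ?_)
    exact (inner_smul_left _ _ _).symm

instance : SeminormedAddCommGroup (PreLimit U) :=
  InnerProductSpace.Core.toSeminormedAddCommGroup (c := preLimitCore U)
instance : InnerProductSpace ℂ (PreLimit U) :=
  InnerProductSpace.ofCore (preLimitCore U)

theorem PreLimit.inner_eq_of_forall_ge {x y : PreLimit U} {c : ℂ} (i : I)
    (h : ∀ j, i ≤ j → ⟪x.1 j, y.1 j⟫_ℂ = c) : ⟪x, y⟫_ℂ = c :=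
  tendsto_nhds_unique (x.tendsto_inner y)
    (tendsto_const_nhds.congr' (eventually_atTop.mpr ⟨i, fun j hj => (h j hj).symm⟩))

variable (U) in
open Classical in
/-- The vectors of `X i`, as eventually compatible families. -/
def preLimitMap
    (hU : ∀ i j k (h : i ≤ j) (h' : j ≤ k) x, U j k h' (U i j h x) = U i k (h.trans h') x)
    (i : I) : X i →ₗᵢ[ℂ] PreLimit U :=
  LinearMap.isometryOfInner
    -- The value 0 off the indices above `i` is immaterial, as the seminorm sees only eventual
    -- values.
    { toFun := fun x => ⟨fun j => if h : i ≤ j then U i j h x else 0, i, fun j k hj hk => by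
        simp only [dif_pos hj, dif_pos (hj.trans hk), hU]⟩
      map_add' := fun x y => Subtype.ext <| funext fun j => by
        change (if h : i ≤ j then U i j h (x + y) else 0) =
          (if h : i ≤ j then U i j h x else 0) + (if h : i ≤ j then U i j h y else 0)
        split_ifs <;> simp
      map_smul' := fun c x => Subtype.ext <| funext fun j => by
        change (if h : i ≤ j then U i j h (c • x) else 0) = c • (if h : i ≤ j then U i j h x else 0)
        split_ifs <;> simp } fun x y => by
    refine PreLimit.inner_eq_of_forall_ge i fun j hj => ?_
    change ⟪(if h : i ≤ j then U i j h x else 0), (if h : i ≤ j then U i j h y else 0)⟫_ℂ = _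
    rw [dif_pos hj, dif_pos hj, LinearIsometry.inner_map_map]

theorem preLimitMap_apply {hU : ∀ i j k (h : i ≤ j) (h' : j ≤ k) x,
      U j k h' (U i j h x) = U i k (h.trans h') x} {i j : I} (h : i ≤ j) (x : X i) :
    (preLimitMap U hU i x).1 j = U i j h x :=
  dif_pos h

theorem PreLimit.norm_eq_zero {x : PreLimit U} (i : I) (h : ∀ j, i ≤ j → x.1 j = 0) :
    ‖x‖ = 0 := by
  have : ⟪x, x⟫_ℂ = 0 := PreLimit.inner_eq_of_forall_ge i fun j hj => by
    rw [h j hj, inner_zero_left]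
  rw [inner_self_eq_norm_sq_to_K] at this
  simpa using this

/-- Inductive limits of Hilbert spaces along isometries. -/
theorem exists_inductiveLimit
    (hU : ∀ i j k (h : i ≤ j) (h' : j ≤ k) x, U j k h' (U i j h x) = U i k (h.trans h') x) :
    ∃ (ι : ∀ i, X i →ₗᵢ[ℂ] UniformSpace.Completion (PreLimit U)),
      (∀ i j (h : i ≤ j) x, ι j (U i j h x) = ι i x) ∧ Dense (⋃ i, Set.range (ι i)) := by
  have hz {x y : PreLimit U} (h : ‖x - y‖ = 0) :
      (x : UniformSpace.Completion (PreLimit U)) = y := by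
    rw [← sub_eq_zero, ← UniformSpace.Completion.coe_sub, ← norm_eq_zero,
      UniformSpace.Completion.norm_coe, h]
  refine ⟨fun i => UniformSpace.Completion.toComplₗᵢ.comp (preLimitMap U hU i),
    fun i j h x => hz (PreLimit.norm_eq_zero j fun k hk => ?_), ?_⟩
  · change (preLimitMap U hU j (U i j h x)).1 k - (preLimitMap U hU i x).1 k = 0
    rw [preLimitMap_apply hk, preLimitMap_apply (h.trans hk), hU, sub_self]
  · refine (UniformSpace.Completion.denseRange_coe (α := PreLimit U)).mono ?_
    rintro _ ⟨x, rfl⟩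
    obtain ⟨i, hi⟩ := x.2
    refine Set.mem_iUnion.mpr ⟨i, x.1 i, hz (PreLimit.norm_eq_zero i fun k hk => ?_)⟩
    change (preLimitMap U hU i (x.1 i)).1 k - x.1 k = 0
    rw [preLimitMap_apply hk, hi i k le_rfl hk, sub_self]

/-- A compatible family of bounded operators extends to the inductive limit. -/
theorem exists_extension_of_compatible {K M : Type*} [NormedAddCommGroup K] [InnerProductSpace ℂ K]
    [NormedAddCommGroup M] [InnerProductSpace ℂ M] [CompleteSpace M]
    (ι : ∀ i, X i →ₗᵢ[ℂ] K) (hι : ∀ i j (h : i ≤ j) x, ι j (U i j h x) = ι i x)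
    (hd : Dense (⋃ i, Set.range (ι i))) (f : ∀ i, X i →L[ℂ] M) (C : ℝ)
    (hf : ∀ i x, ‖f i x‖ ≤ C * ‖x‖) (hc : ∀ i j (h : i ≤ j) x, f j (U i j h x) = f i x) :
    ∃ F : K →L[ℂ] M, ∀ i x, F (ι i x) = f i x := by
  classical
  let e : (DirectSum I X) →ₗ[ℂ] K := DirectSum.toModule ℂ I K fun i => (ι i).toLinearMap
  let g : (DirectSum I X) →ₗ[ℂ] M := DirectSum.toModule ℂ I M fun i => (f i).toLinearMap
  -- Directedness brings a finite sum to one level, so the uniform bound on the `f i` bounds `g`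
  -- against `e`.
  have hrep (x : DirectSum I X) : ∃ i, ∃ z : X i, e x = ι i z ∧ g x = f i z := by
    induction x using DirectSum.induction_on with
    | zero => exact ⟨Classical.arbitrary I, 0, by simp, by simp⟩
    | of i z => exact ⟨i, z, DirectSum.toModule_lof ℂ i z, DirectSum.toModule_lof ℂ i z⟩
    | add x y hx hy =>
      obtain ⟨i, z, h1, h2⟩ := hx
      obtain ⟨j, z', h3, h4⟩ := hy
      obtain ⟨k, hik, hjk⟩ := exists_ge_ge i j
      refine ⟨k, U i k hik z + U j k hjk z', ?_, ?_⟩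
      · rw [map_add, map_add, hι, hι, h1, h3]
      · rw [map_add, map_add, hc, hc, h2, h4]
  have hde : DenseRange e := hd.mono <| Set.iUnion_subset fun i => by
    rintro _ ⟨z, rfl⟩
    exact ⟨DirectSum.lof ℂ I X i z, DirectSum.toModule_lof ℂ i z⟩
  refine ⟨g.extendOfNorm e, fun i x => ?_⟩
  have h := LinearMap.extendOfNorm_eq (f := g) hde ⟨C, fun x => by
    obtain ⟨i, z, h1, h2⟩ := hrep x
    rw [h1, h2, LinearIsometry.norm_map]
    exact hf i z⟩ (DirectSum.lof ℂ I X i x)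
  rwa [show e _ = ι i x from DirectSum.toModule_lof ℂ i x,
    show g _ = f i x from DirectSum.toModule_lof ℂ i x] at h

end Limit

/-! ### Isometries out of `E ⊗_σ H`. -/

section Isometry

variable {H₀ : Type w} [NormedAddCommGroup H₀] [InnerProductSpace ℂ H₀] [CompleteSpace H₀]
  {N : VonNeumannAlgebra H₀}
  {H : Type v} [NormedAddCommGroup H] [InnerProductSpace ℂ H] [CompleteSpace H]
  {σ : N →⋆ₙₐ[ℂ] (H →L[ℂ] H)}
  {E : Type u} [NormedAddCommGroup E] [NormedSpace ℂ E] [CompleteSpace E]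
  [Module (↥N)ᵐᵒᵖ E] [HilbertModule N E]
  {M : Type*} [NormedAddCommGroup M] [InnerProductSpace ℂ M] [CompleteSpace M]

/-- A bilinear map with the inner products of `E ⊗_σ H` extends to an isometry of `E ⊗_σ H`. -/
theorem exists_isometry_of_inner (b : E →ₗ[ℂ] H →ₗ[ℂ] M)
    (hb : ∀ ξ h η k, ⟪b ξ h, b η k⟫_ℂ = ⟪h, σ (ip N ξ η) k⟫_ℂ) :
    ∃ U : InteriorTensor E σ →ₗᵢ[ℂ] M, ∀ ξ h, U (tensorVec σ ξ h) = b ξ h := by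
  have h1 (x y : E ⊗[ℂ] H) :
      ⟪TensorProduct.lift b x, TensorProduct.lift b y⟫_ℂ = tensorForm σ x y := by
    induction x using TensorProduct.induction_on with
    | zero => simp
    | add x₁ x₂ h₁ h₂ => simp [h₁, h₂]
    | tmul ξ k =>
      induction y using TensorProduct.induction_on with
      | zero => simp
      | add y₁ y₂ h₁ h₂ => simp only [map_add, h₁, h₂, inner_add_right]
      | tmul η l => simp [hb]
  have h2 (x : E ⊗[ℂ] H) : ‖TensorProduct.lift b x‖ = ‖toTensor σ x‖ := by
    rw [← sq_eq_sq₀ (norm_nonneg _) (norm_nonneg _), norm_sq_toTensor, ← h1]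
    exact norm_sq_eq_re_inner (𝕜 := ℂ) _
  have h3 := LinearMap.extendOfNorm_eq (f := TensorProduct.lift b)
    (denseRange_toTensor (E := E) σ) ⟨1, fun x => by rw [h2, one_mul]⟩
  refine ⟨⟨((TensorProduct.lift b).extendOfNorm (toTensor σ)).toLinearMap, fun x => ?_⟩,
    fun ξ h => (h3 (ξ ⊗ₜ h)).trans (TensorProduct.lift.tmul _ _)⟩
  refine (denseRange_toTensor (E := E) σ).induction_on x
    (isClosed_eq (by fun_prop) (by fun_prop)) fun y => ?_
  rw [← h2, ← h3 y]
  rfl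

end Isometry

/-! ### The directed system of the spaces `E t ⊗ H`. -/

section System

variable {H₀ : Type w} [NormedAddCommGroup H₀] [InnerProductSpace ℂ H₀] [CompleteSpace H₀]
  {N : VonNeumannAlgebra H₀}
  {E : ℝ≥0 → Type u}
  [∀ t, NormedAddCommGroup (E t)] [∀ t, NormedSpace ℂ (E t)] [∀ t, CompleteSpace (E t)]
  [∀ t, Module (↥N)ᵐᵒᵖ (E t)] [∀ t, WStarCorrespondence N (E t)]
  {P : DiscreteProductSystem N E}
  {H : Type v} [NormedAddCommGroup H] [InnerProductSpace ℂ H] [CompleteSpace H]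

namespace CovariantRep

section Creation

variable (T : CovariantRep P H)

/-- The Hilbert space `E t ⊗ H`. -/
abbrev Tensor (t : ℝ≥0) : Type (max u v) := InteriorTensor (E t) T.rep

/-- The creation operators of the product system. -/
abbrev create {t s r : ℝ≥0} (h : t + s = r) : E t →ₗ[ℂ] (T.Tensor s →L[ℂ] T.Tensor r) :=
  creation T.rep (P.isTensorIso_mul h)

theorem create_mul {t s r p q x : ℝ≥0} (h₁ : t + s = p) (h₂ : p + r = x) (h₃ : s + r = q)
    (h₄ : t + q = x) (ξ : E t) (η : E s) (y : T.Tensor r) :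
    T.create h₂ (P.mul h₁ ξ η) y = T.create h₄ ξ (T.create h₃ η y) := by
  have : T.create h₂ (P.mul h₁ ξ η) = T.create h₄ ξ ∘L T.create h₃ η :=
    tensor_ext T.rep fun ζ k => by simp [P.mul_assoc h₁ h₂ h₃ h₄]
  rw [this]; rfl

theorem create_unit {s : ℝ≥0} (a : N) :
    T.create (zero_add s) (P.unit a) = leftRep T.rep (E s) a :=
  tensor_ext T.rep fun ζ k => by simp [P.unit_mul]

theorem norm_create_le {t s r : ℝ≥0} (h : t + s = r) (ξ : E t) (x : T.Tensor s) :
    ‖T.create h ξ x‖ ≤ ‖ξ‖ * ‖x‖ := by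
  refine le_of_sq_le_sq ?_ (by positivity)
  rw [norm_sq_eq_re_inner (𝕜 := ℂ), inner_creation_creation]
  refine (RCLike.re_le_norm _).trans <| (norm_inner_le_norm _ _).trans ?_
  calc _ ≤ ‖x‖ * (‖ip N ξ ξ‖ * ‖x‖) := by
        gcongr
        refine (ContinuousLinearMap.le_opNorm _ _).trans ?_
        gcongr
        exact norm_rep_le _ _
    _ = _ := by rw [ip, ← HilbertModule.norm_sq]; ring

end Creation

variable {T : CovariantRep P H} (hT : T.IsFullyCoisometric)

/-- The coisometry `T̃_t : E t ⊗ H → H`. -/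
def tilde (t : ℝ≥0) : T.Tensor t →L[ℂ] H := Classical.choose (hT t)

@[simp] theorem tilde_tensorVec {t : ℝ≥0} (ξ : E t) (h : H) :
    tilde hT t (tensorVec T.rep ξ h) = T.T t ξ h :=
  (Classical.choose_spec (hT t)).1 ξ h

theorem tilde_adjoint_apply (t : ℝ≥0) (h : H) : tilde hT t ((tilde hT t).adjoint h) = h :=
  congrArg (fun S : H →L[ℂ] H => S h) (Classical.choose_spec (hT t)).2

/-- This is multiplicativity of `T`, in the form `T̃_{t+s} = T̃_t (I ⊗ T̃_s)`; the compatibility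
relations below derive from it. -/
theorem tilde_create {t s r : ℝ≥0} (h : t + s = r) (ξ : E t) (x : T.Tensor s) :
    tilde hT r (T.create h ξ x) = T.T t ξ (tilde hT s x) := by
  have : tilde hT r ∘L T.create h ξ = T.T t ξ ∘L tilde hT s :=
    tensor_ext T.rep fun ζ k => by simp [T.T_mul h]
  exact congrArg (fun S => S x) this

theorem tilde_leftRep {s : ℝ≥0} (a : N) (x : T.Tensor s) :
    tilde hT s (leftRep T.rep (E s) a x) = T.rep a (tilde hT s x) := by
  rw [← create_unit, tilde_create, T.T_unit]

/-- `T̃_s` intertwines the left action with `T_0`, and `T̃_s T̃_s⋆ = I`. This is what makes `I ⊗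
T̃_s⋆` preserve inner products. -/
theorem inner_tilde_adjoint_leftRep {s : ℝ≥0} (a : N) (h k : H) :
    ⟪(tilde hT s).adjoint h, leftRep T.rep (E s) a ((tilde hT s).adjoint k)⟫_ℂ =
      ⟪h, T.rep a k⟫_ℂ := by
  rw [ContinuousLinearMap.adjoint_inner_left, tilde_leftRep, tilde_adjoint_apply]

theorem exists_connect {t r s : ℝ≥0} (h : t + r = s) :
    ∃ U : T.Tensor t →ₗᵢ[ℂ] T.Tensor s, ∀ (ξ : E t) (k : H),
      U (tensorVec T.rep ξ k) = T.create h ξ ((tilde hT r).adjoint k) :=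
  exists_isometry_of_inner
    (LinearMap.mk₂ ℂ (fun ξ k => T.create h ξ ((tilde hT r).adjoint k))
      (by simp) (by simp) (by simp) (by simp))
    fun ξ k η l => by
      simp only [LinearMap.mk₂_apply, inner_creation_creation, inner_tilde_adjoint_leftRep]

/-- The isometry `I ⊗ T̃_r⋆` from `E t ⊗ H` to `E (t + r) ⊗ H`. -/
def connect {t r s : ℝ≥0} (h : t + r = s) : T.Tensor t →ₗᵢ[ℂ] T.Tensor s :=
  Classical.choose (exists_connect hT h)

@[simp] theorem connect_tensorVec {t r s : ℝ≥0} (h : t + r = s) (ξ : E t) (k : H) :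
    connect hT h (tensorVec T.rep ξ k) = T.create h ξ ((tilde hT r).adjoint k) :=
  Classical.choose_spec (exists_connect hT h) ξ k

theorem connect_create {t s a r b c : ℝ≥0} (h₁ : t + s = a) (h₂ : a + r = c) (h₃ : s + r = b)
    (h₄ : t + b = c) (ξ : E t) (x : T.Tensor s) :
    connect hT h₂ (T.create h₁ ξ x) = T.create h₄ ξ (connect hT h₃ x) := by
  have : (connect hT h₂).toContinuousLinearMap ∘L T.create h₁ ξ =
      T.create h₄ ξ ∘L (connect hT h₃).toContinuousLinearMap :=
    tensor_ext T.rep fun ζ k => by simp [T.create_mul h₁ h₂ h₃ h₄]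
  exact congrArg (fun S => S x) this

/-- The adjoint of `I ⊗ T̃_r⋆` is `I ⊗ T̃_r`. -/
theorem inner_create_connect {t r s : ℝ≥0} (h : t + r = s) (η : E t) (y : T.Tensor r)
    (x : T.Tensor t) :
    ⟪T.create h η y, connect hT h x⟫_ℂ = ⟪tensorVec T.rep η (tilde hT r y), x⟫_ℂ := by
  have : innerSL ℂ (T.create h η y) ∘L (connect hT h).toContinuousLinearMap =
      innerSL ℂ (tensorVec T.rep η (tilde hT r y)) :=
    tensor_ext T.rep fun ξ k => by
      change ⟪T.create h η y, connect hT h (tensorVec T.rep ξ k)⟫_ℂ =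
        ⟪tensorVec T.rep η (tilde hT r y), tensorVec T.rep ξ k⟫_ℂ
      have hs (a : N) : ContinuousLinearMap.adjoint (leftRep T.rep (E r) a) =
          leftRep T.rep (E r) (star a) := by
        rw [map_star, ContinuousLinearMap.star_eq_adjoint]
      rw [connect_tensorVec, inner_creation_creation, inner_tensorVec,
        ← ContinuousLinearMap.adjoint_inner_left, hs, ContinuousLinearMap.adjoint_inner_right,
        tilde_leftRep, map_star, ContinuousLinearMap.star_eq_adjoint,
        ContinuousLinearMap.adjoint_inner_left]
  exact congrArg (fun S => S x) this

theorem inner_ext_of_span {K : Type*} [NormedAddCommGroup K] [InnerProductSpace ℂ K] {D : Set K}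
    (hD : (Submodule.span ℂ D).topologicalClosure = ⊤) {y z : K}
    (h : ∀ d ∈ D, ⟪d, y⟫_ℂ = ⟪d, z⟫_ℂ) : y = z := by
  have h1 : (Submodule.span ℂ D).topologicalClosure ≤ (innerSL ℂ (y - z)).toLinearMap.ker := by
    refine Submodule.topologicalClosure_minimal _ (Submodule.span_le.mpr fun d hd => ?_)
      (innerSL ℂ (y - z)).isClosed_ker
    have := congrArg (starRingEnd ℂ) (h d hd)
    simp only [inner_conj_symm] at this
    change ⟪y - z, d⟫_ℂ = 0
    rw [inner_sub_left, this, sub_self]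
  rw [hD] at h1
  rw [← sub_eq_zero, ← inner_self_eq_zero (𝕜 := ℂ)]
  exact h1 (Submodule.mem_top (x := y - z))

/-- The adjoint of `T̃_p = T̃_r (I ⊗ T̃_q)`, tested on the vectors `η ⊗ y`, which are total because
`T_0` is normal. -/
theorem connect_tilde_adjoint {r q p : ℝ≥0} (h : r + q = p) (k : H) :
    connect hT h ((tilde hT r).adjoint k) = (tilde hT p).adjoint k := by
  refine inner_ext_of_span (topologicalClosure_span_creation T.rep (P.isTensorIso_mul h)
    T.isNormalRep_rep) ?_
  rintro _ ⟨⟨η, y⟩, rfl⟩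
  change ⟪T.create h η y, _⟫_ℂ = ⟪T.create h η y, _⟫_ℂ
  rw [inner_create_connect, ContinuousLinearMap.adjoint_inner_right,
    ContinuousLinearMap.adjoint_inner_right, tilde_create, tilde_tensorVec]

theorem connect_connect {t r s q p x : ℝ≥0} (h₁ : t + r = s) (h₂ : s + q = x) (h₃ : r + q = p)
    (h₄ : t + p = x) (y : T.Tensor t) :
    connect hT h₂ (connect hT h₁ y) = connect hT h₄ y := by
  have : (connect hT h₂).toContinuousLinearMap ∘L (connect hT h₁).toContinuousLinearMap =
      (connect hT h₄).toContinuousLinearMap :=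
    tensor_ext T.rep fun ζ k => by
      simp [connect_create hT h₁ h₂ h₃ h₄, connect_tilde_adjoint hT h₃]
  exact congrArg (fun S => S y) this

/-- The Hilbert space `K` is the inductive limit of the spaces `E t ⊗ H`. -/
structure LimitSpace (hT : T.IsFullyCoisometric) (K : Type*) [NormedAddCommGroup K]
    [InnerProductSpace ℂ K] where
  ι : ∀ t, T.Tensor t →ₗᵢ[ℂ] K
  ι_connect : ∀ {t r s : ℝ≥0} (h : t + r = s) (x : T.Tensor t), ι s (connect hT h x) = ι t x
  dense : Dense (⋃ t, Set.range (ι t))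

theorem exists_limitSpace : ∃ (K : Type (max u v)) (_ : NormedAddCommGroup K)
    (_ : InnerProductSpace ℂ K) (_ : CompleteSpace K), Nonempty (LimitSpace hT K) := by
  let U (i j : ℝ≥0) (h : i ≤ j) : T.Tensor i →ₗᵢ[ℂ] T.Tensor j :=
    connect hT (add_tsub_cancel_of_le h)
  have hU (i j k : ℝ≥0) (h : i ≤ j) (h' : j ≤ k) (x : T.Tensor i) :
      U j k h' (U i j h x) = U i k (h.trans h') x :=
    connect_connect hT _ _ (by rw [add_comm, tsub_add_tsub_cancel h' h]) _ x
  obtain ⟨ι, h1, h2⟩ := exists_inductiveLimit (U := U) hU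
  refine ⟨UniformSpace.Completion (PreLimit U), inferInstance, inferInstance, inferInstance,
    ⟨⟨ι, fun {t r s} h x => ?_, h2⟩⟩⟩
  have hr : r = s - t := by rw [← h, add_tsub_cancel_left]
  subst hr
  exact h1 t s (h ▸ le_self_add) x

/-! ### The dilation on the inductive limit. -/

namespace LimitSpace

variable {hT} {K : Type*} [NormedAddCommGroup K] [InnerProductSpace ℂ K] [CompleteSpace K]
  (L : LimitSpace hT K)

omit [CompleteSpace K] in
include L in
theorem exists_extension {M : Type*} [NormedAddCommGroup M] [InnerProductSpace ℂ M]
    [CompleteSpace M] (f : ∀ t, T.Tensor t →L[ℂ] M) (C : ℝ) (hf : ∀ t x, ‖f t x‖ ≤ C * ‖x‖)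
    (hc : ∀ {t r s : ℝ≥0} (h : t + r = s) (x : T.Tensor t), f s (connect hT h x) = f t x) :
    ∃ F : K →L[ℂ] M, ∀ t x, F (L.ι t x) = f t x :=
  exists_extension_of_compatible
    (U := fun _ _ h => connect hT (add_tsub_cancel_of_le h)) L.ι (fun _ _ _ x => L.ι_connect _ x)
    L.dense f C hf (fun _ _ _ x => hc _ x)

omit [CompleteSpace K] in
theorem ext {M : Type*} [NormedAddCommGroup M] [NormedSpace ℂ M]
    {f g : K →L[ℂ] M} (h : ∀ t x, f (L.ι t x) = g (L.ι t x)) : f = g := by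
  refine ContinuousLinearMap.ext fun x => ?_
  refine congrFun (Continuous.ext_on L.dense f.continuous g.continuous ?_) x
  rintro _ ⟨_, ⟨t, rfl⟩, y, rfl⟩
  exact h t y

omit [CompleteSpace K] in
theorem exists_common (t s : ℝ≥0) (x : T.Tensor t) (y : T.Tensor s) :
    ∃ (r : ℝ≥0) (x' y' : T.Tensor r), L.ι r x' = L.ι t x ∧ L.ι r y' = L.ι s y :=
  ⟨t + s, connect hT rfl x, connect hT (add_comm s t) y, L.ι_connect _ _, L.ι_connect _ _⟩

omit [CompleteSpace K] in
theorem topologicalClosure_span :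
    (Submodule.span ℂ (⋃ t, Set.range (L.ι t))).topologicalClosure = ⊤ := by
  rw [← Submodule.dense_iff_topologicalClosure_eq_top]
  exact L.dense.mono Submodule.subset_span

omit [CompleteSpace K] in
theorem inner_ext {A B : K →L[ℂ] K}
    (h : ∀ t x y, ⟪L.ι t x, A (L.ι t y)⟫_ℂ = ⟪L.ι t x, B (L.ι t y)⟫_ℂ) : A = B := by
  refine L.ext fun t y => inner_ext_of_span L.topologicalClosure_span ?_
  rintro _ ⟨_, ⟨s, rfl⟩, x, rfl⟩
  obtain ⟨r, x', y', hx, hy⟩ := L.exists_common s t x y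
  rw [← hx, ← hy]
  exact h r x' y'

/-- Creation acts on the left leg and the connecting isometries on the right one, so they commute
(`connect_create`). -/
theorem exists_shift {t : ℝ≥0} (ξ : E t) : ∃ F : K →L[ℂ] K, ∀ s x,
    F (L.ι s x) = L.ι (t + s) (T.create rfl ξ x) :=
  L.exists_extension (fun s => (L.ι (t + s)).toContinuousLinearMap ∘L T.create rfl ξ) ‖ξ‖
    (fun s x => by
      change ‖L.ι (t + s) _‖ ≤ _
      rw [LinearIsometry.norm_map]
      exact T.norm_create_le rfl ξ x)
    (fun {s r p} h x => by
      change L.ι (t + p) (T.create rfl ξ (connect hT h x)) = L.ι (t + s) (T.create rfl ξ x)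
      rw [← connect_create hT rfl (by rw [← h, add_assoc]) h rfl, L.ι_connect])

/-- The operators `V_t(ξ)` on the inductive limit. -/
def V (t : ℝ≥0) : E t →ₗ[ℂ] (K →L[ℂ] K) :=
  have h (ξ : E t) := Classical.choose_spec (L.exists_shift ξ)
  { toFun := fun ξ => Classical.choose (L.exists_shift ξ)
    map_add' := fun ξ η => L.ext fun s x => by
      rw [add_apply, h, h, h, map_add, add_apply, map_add]
    map_smul' := fun c ξ => L.ext fun s x => by
      rw [RingHom.id_apply, smul_apply, h, h, map_smul, smul_apply, map_smul] }

theorem V_ι {t s r : ℝ≥0} (h : t + s = r) (ξ : E t) (x : T.Tensor s) :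
    L.V t ξ (L.ι s x) = L.ι r (T.create h ξ x) := by
  subst h
  exact Classical.choose_spec (L.exists_shift ξ) s x

theorem V_unit_ι {s : ℝ≥0} (a : N) (x : T.Tensor s) :
    L.V 0 (P.unit a) (L.ι s x) = L.ι s (leftRep T.rep (E s) a x) := by
  rw [L.V_ι (zero_add s), create_unit]

/-- `V_0` as a `⋆`-representation of `N`. -/
def rep : N →⋆ₙₐ[ℂ] (K →L[ℂ] K) where
  toFun a := L.V 0 (P.unit a)
  map_smul' c a := by rw [map_smul, map_smul]; rfl
  map_zero' := by rw [map_zero, map_zero]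
  map_add' a b := by rw [map_add, map_add]
  map_mul' a b := L.ext fun s x => by
    rw [mul_apply_eq_comp, V_unit_ι, V_unit_ι, V_unit_ι, map_mul]; rfl
  map_star' a := L.inner_ext fun s x y => by
    rw [ContinuousLinearMap.star_eq_adjoint, ContinuousLinearMap.adjoint_inner_right, V_unit_ι,
      V_unit_ι, LinearIsometry.inner_map_map, LinearIsometry.inner_map_map, map_star,
      ContinuousLinearMap.star_eq_adjoint, ContinuousLinearMap.adjoint_inner_right]

theorem rep_ι {s : ℝ≥0} (a : N) (x : T.Tensor s) :
    L.rep a (L.ι s x) = L.ι s (leftRep T.rep (E s) a x) := L.V_unit_ι a x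

theorem isNormalRep_rep : IsNormalRep L.rep := by
  refine isNormalRep_of_dense _ L.topologicalClosure_span ?_
  rintro _ ⟨_, ⟨t, rfl⟩, x, rfl⟩ _ ⟨_, ⟨s, rfl⟩, y, rfl⟩
  obtain ⟨r, x', y', hx, hy⟩ := L.exists_common t s x y
  rw [← hx, ← hy]
  have := isNormalRep_leftRep (F := E r) T.rep T.isNormalRep_rep x' y'
  convert this using 1
  ext a
  simp [rep_ι]

theorem isometric (t : ℝ≥0) (ξ η : E t) : star (L.V t ξ) * L.V t η = L.rep (ip N ξ η) :=
  L.inner_ext fun s x y => by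
    rw [mul_apply_eq_comp, ContinuousLinearMap.star_eq_adjoint,
      ContinuousLinearMap.adjoint_inner_right, L.V_ι rfl, L.V_ι rfl, rep_ι,
      LinearIsometry.inner_map_map, LinearIsometry.inner_map_map, inner_creation_creation]

/-- The covariant representation on the inductive limit. -/
def covariantRep : CovariantRep P K where
  T := L.V
  completelyContractive t := isCompletelyContractive_of_isometric (L.isometric t)
  continuous t := sigmaTopology_continuous_of_isometric L.isNormalRep_rep (L.isometric t)
  rep := L.rep
  T_unit _ := rfl
  T_mul {t s r} h ξ η := L.ext fun p x => by
    rw [mul_apply_eq_comp, L.V_ι (show s + p = s + p from rfl),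
      L.V_ι (show t + (s + p) = r + p by rw [← h, add_assoc]), L.V_ι rfl,
      T.create_mul h rfl rfl]

/-- The embedding of `H` into the inductive limit. -/
def embed : H →ₗᵢ[ℂ] K :=
  (L.ι 0).comp
    ⟨(tilde hT 0).adjoint.toLinearMap, fun h => by
      change ‖(tilde hT 0).adjoint h‖ = _
      rw [← sq_eq_sq₀ (norm_nonneg _) (norm_nonneg _), norm_sq_eq_re_inner (𝕜 := ℂ),
        norm_sq_eq_re_inner (𝕜 := ℂ), ContinuousLinearMap.adjoint_inner_left,
        tilde_adjoint_apply]⟩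

-- The embedding can be read at any level, since the connecting isometries carry `T̃_0⋆` to `T̃_t⋆`.
omit [CompleteSpace K] in
theorem embed_eq (t : ℝ≥0) (h : H) : L.embed h = L.ι t ((tilde hT t).adjoint h) := by
  rw [← connect_tilde_adjoint hT (zero_add t), L.ι_connect]
  rfl

theorem V_embed {t : ℝ≥0} (ξ : E t) (h : H) :
    L.V t ξ (L.embed h) = L.ι t (tensorVec T.rep ξ h) := by
  rw [L.embed_eq 0, L.V_ι (add_zero t), ← connect_tensorVec, L.ι_connect]

/-- Dual to `tilde_create`: the embedding is read at level `t + s` on one side and at level `s` on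
the other. Coinvariance and compression both follow. -/
theorem adjoint_V_embed {t : ℝ≥0} (ξ : E t) (h : H) :
    (L.V t ξ).adjoint (L.embed h) = L.embed ((T.T t ξ).adjoint h) := by
  refine inner_ext_of_span L.topologicalClosure_span ?_
  rintro _ ⟨_, ⟨s, rfl⟩, x, rfl⟩
  rw [ContinuousLinearMap.adjoint_inner_right, L.V_ι rfl, L.embed_eq (t + s), L.embed_eq s,
    LinearIsometry.inner_map_map, LinearIsometry.inner_map_map,
    ContinuousLinearMap.adjoint_inner_right, ContinuousLinearMap.adjoint_inner_right,
    tilde_create, ContinuousLinearMap.adjoint_inner_right]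

theorem closed_eq_top {M : Submodule ℂ K} (hM : IsClosed (M : Set K))
    (h : ∀ t (ξ : E t) (k : H), L.V t ξ (L.embed k) ∈ M) : M = ⊤ := by
  rw [eq_top_iff, ← L.topologicalClosure_span]
  refine Submodule.topologicalClosure_minimal _ (Submodule.span_le.mpr ?_) hM
  rintro _ ⟨_, ⟨t, rfl⟩, x, rfl⟩
  have h1 : (⊤ : Submodule ℂ (T.Tensor t)) ≤ M.comap (L.ι t).toLinearMap := by
    rw [← topologicalClosure_span_tensorVec (E := E t) T.rep]
    refine Submodule.topologicalClosure_minimal _ (Submodule.span_le.mpr ?_)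
      (hM.preimage (L.ι t).continuous)
    rintro _ ⟨⟨ξ, k⟩, rfl⟩
    change L.ι t (tensorVec T.rep ξ k) ∈ M
    rw [← V_embed]
    exact h t ξ k
  exact h1 (Submodule.mem_top (x := x))

/-- Level `s` lies in level `t + s`, that is `E(t) ⊗ E(s) ⊗ H`, where the vectors created by `E(t)`
from level `s` are total. -/
theorem topologicalClosure_span_V (t : ℝ≥0) :
    (Submodule.span ℂ (Set.range fun p : E t × K => L.V t p.1 p.2)).topologicalClosure = ⊤ := by
  set M := (Submodule.span ℂ (Set.range fun p : E t × K => L.V t p.1 p.2)).topologicalClosure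
  have hM : IsClosed (M : Set K) := Submodule.isClosed_topologicalClosure _
  refine L.closed_eq_top hM fun s ξ k => ?_
  rw [V_embed, ← L.ι_connect (add_comm s t)]
  have h1 : (⊤ : Submodule ℂ (T.Tensor (t + s))) ≤ M.comap (L.ι (t + s)).toLinearMap := by
    rw [← topologicalClosure_span_creation T.rep (P.isTensorIso_mul (rfl : t + s = t + s))
      T.isNormalRep_rep]
    refine Submodule.topologicalClosure_minimal _ (Submodule.span_le.mpr ?_)
      (hM.preimage (L.ι (t + s)).continuous)
    rintro _ ⟨⟨η, x⟩, rfl⟩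
    refine Submodule.le_topologicalClosure _ (Submodule.subset_span ⟨(η, L.ι s x), ?_⟩)
    exact L.V_ι rfl η x
  exact h1 (Submodule.mem_top (x := connect hT (add_comm s t) (tensorVec T.rep ξ k)))

/-- `Ṽ_t` is an isometry, so its range is closed; it contains the total set of vectors `V_t(ξ) k`,
so `Ṽ_t` is unitary. -/
theorem isFullyCoisometric : L.covariantRep.IsFullyCoisometric := by
  intro t
  obtain ⟨S, hS⟩ := exists_isometry_of_inner (σ := L.rep) (E := E t)
    (LinearMap.mk₂ ℂ (fun ξ (k : K) => L.V t ξ k) (by simp) (by simp) (by simp) (by simp))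
    (fun ξ h η k => by
      rw [← L.isometric, mul_apply_eq_comp, ContinuousLinearMap.star_eq_adjoint,
        ContinuousLinearMap.adjoint_inner_right]
      rfl)
  have hsurj : S.toLinearMap.range = ⊤ := by
    rw [eq_top_iff, ← L.topologicalClosure_span_V t]
    refine Submodule.topologicalClosure_minimal _ (Submodule.span_le.mpr ?_)
      S.isometry.isClosedEmbedding.isClosed_range
    rintro _ ⟨⟨ξ, k⟩, rfl⟩
    exact ⟨tensorVec L.rep ξ k, hS ξ k⟩
  refine ⟨S.toContinuousLinearMap, hS, ?_⟩
  ext y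
  obtain ⟨x, rfl⟩ := LinearMap.range_eq_top.mp hsurj y
  have : S.toContinuousLinearMap.adjoint (S x) = x := by
    refine ext_inner_left ℂ fun z => ?_
    rw [ContinuousLinearMap.adjoint_inner_right]
    exact S.inner_map_map z x
  change S (S.toContinuousLinearMap.adjoint (S x)) = S x
  rw [this]

theorem isMinimalIsometricDilation : IsMinimalIsometricDilation T L.covariantRep L.embed where
  fullyCoisometric := L.isFullyCoisometric
  isometric := L.isometric
  compression t ξ := by
    ext h
    refine ext_inner_left ℂ fun k => ?_
    rw [ContinuousLinearMap.comp_apply, ContinuousLinearMap.adjoint_inner_right]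
    change ⟪L.embed k, L.V t ξ (L.embed h)⟫_ℂ = _
    rw [← ContinuousLinearMap.adjoint_inner_left, adjoint_V_embed, LinearIsometry.inner_map_map,
      ContinuousLinearMap.adjoint_inner_left]
  coinvariant := by
    rintro t ξ _ ⟨h, rfl⟩
    exact ⟨_, (L.adjoint_V_embed ξ h).symm⟩
  minimal M hM hH hV := L.closed_eq_top hM fun t ξ k => (hV t ξ _ (hH ⟨k, rfl⟩)).1

end LimitSpace

end CovariantRep

end System

/-! ### Uniqueness of the minimal isometric dilation. -/

namespace IsMinimalIsometricDilation

variable {H₀ : Type w} [NormedAddCommGroup H₀] [InnerProductSpace ℂ H₀] [CompleteSpace H₀]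
  {N : VonNeumannAlgebra H₀}
  {E : ℝ≥0 → Type u}
  [∀ t, NormedAddCommGroup (E t)] [∀ t, NormedSpace ℂ (E t)] [∀ t, CompleteSpace (E t)]
  [∀ t, Module (↥N)ᵐᵒᵖ (E t)] [∀ t, WStarCorrespondence N (E t)]
  {P : DiscreteProductSystem N E}
  {H : Type v} [NormedAddCommGroup H] [InnerProductSpace ℂ H] [CompleteSpace H]
  {T : CovariantRep P H} {K' : Type z} [NormedAddCommGroup K'] [InnerProductSpace ℂ K']
  [CompleteSpace K'] {V' : CovariantRep P K'} {u₀' : H →ₗᵢ[ℂ] K'}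
  (D : IsMinimalIsometricDilation T V' u₀')

include D

theorem inner_apply {t : ℝ≥0} (ξ : E t) (h k : H) :
    ⟪u₀' h, V'.T t ξ (u₀' k)⟫_ℂ = ⟪h, T.T t ξ k⟫_ℂ := by
  rw [← D.compression t ξ]
  exact (ContinuousLinearMap.adjoint_inner_right u₀'.toContinuousLinearMap _ _).symm

theorem inner_rep (a : N) (h k : H) : ⟪u₀' h, V'.rep a (u₀' k)⟫_ℂ = ⟪h, T.rep a k⟫_ℂ := by
  rw [← V'.T_unit, ← T.T_unit, D.inner_apply]

theorem inner_T_T {t : ℝ≥0} (ξ η : E t) (x y : K') :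
    ⟪V'.T t ξ x, V'.T t η y⟫_ℂ = ⟪x, V'.rep (ip N ξ η) y⟫_ℂ := by
  rw [← D.isometric, mul_apply_eq_comp, ContinuousLinearMap.star_eq_adjoint,
    ContinuousLinearMap.adjoint_inner_right]

/-- Isometry of `V'` and compression give `⟨V'_t(ξ) u₀' h, V'_t(η) u₀' k⟩ = ⟨h, T_0(⟨ξ, η⟩) k⟩`,
which depends on `T` alone. -/
theorem exists_fromTensor (t : ℝ≥0) : ∃ f : T.Tensor t →ₗᵢ[ℂ] K',
    ∀ ξ h, f (tensorVec T.rep ξ h) = V'.T t ξ (u₀' h) :=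
  exists_isometry_of_inner
    (LinearMap.mk₂ ℂ (fun ξ h => V'.T t ξ (u₀' h)) (by simp) (by simp) (by simp) (by simp))
    fun ξ h η k => by simp only [LinearMap.mk₂_apply, D.inner_T_T, D.inner_rep]

/-- The isometry `ξ ⊗ h ↦ V'_t(ξ) u₀' h` of `E t ⊗ H`. -/
def fromTensor (t : ℝ≥0) : T.Tensor t →ₗᵢ[ℂ] K' := Classical.choose (D.exists_fromTensor t)

@[simp] theorem fromTensor_tensorVec {t : ℝ≥0} (ξ : E t) (h : H) :
    D.fromTensor t (tensorVec T.rep ξ h) = V'.T t ξ (u₀' h) :=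
  Classical.choose_spec (D.exists_fromTensor t) ξ h

theorem fromTensor_create {t s r : ℝ≥0} (h : t + s = r) (ξ : E t) (x : T.Tensor s) :
    D.fromTensor r (T.create h ξ x) = V'.T t ξ (D.fromTensor s x) := by
  have : (D.fromTensor r).toContinuousLinearMap ∘L T.create h ξ =
      V'.T t ξ ∘L (D.fromTensor s).toContinuousLinearMap :=
    tensor_ext T.rep fun ζ k => by simp [V'.T_mul h]
  exact congrArg (fun S => S x) this

variable (hT : T.IsFullyCoisometric)

/-- Both vectors have norm `‖k‖` and their inner product is `‖k‖²`, so their difference has norm 0.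
This makes the isometries on the levels compatible with the connecting maps. -/
theorem fromTensor_tilde_adjoint (r : ℝ≥0) (k : H) :
    D.fromTensor r ((CovariantRep.tilde hT r).adjoint k) = u₀' k := by
  have h1 (x : T.Tensor r) :
      ⟪u₀' k, D.fromTensor r x⟫_ℂ = ⟪k, CovariantRep.tilde hT r x⟫_ℂ := by
    have : innerSL ℂ (u₀' k) ∘L (D.fromTensor r).toContinuousLinearMap =
        innerSL ℂ k ∘L CovariantRep.tilde hT r :=
      tensor_ext T.rep fun ζ h => by simp [D.inner_apply]
    exact congrArg (fun S => S x) this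
  set y := (CovariantRep.tilde hT r).adjoint k with hy
  have h2 : ⟪u₀' k, D.fromTensor r y⟫_ℂ = ⟪k, k⟫_ℂ := by
    rw [h1, hy, CovariantRep.tilde_adjoint_apply]
  have h3 : ⟪D.fromTensor r y, D.fromTensor r y⟫_ℂ = ⟪k, k⟫_ℂ := by
    rw [LinearIsometry.inner_map_map]
    nth_rw 1 [hy]
    rw [ContinuousLinearMap.adjoint_inner_left, hy, CovariantRep.tilde_adjoint_apply]
  have h4 : ⟪D.fromTensor r y, u₀' k⟫_ℂ = ⟪k, k⟫_ℂ := by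
    rw [← inner_conj_symm, h2, inner_conj_symm]
  rw [← sub_eq_zero, ← inner_self_eq_zero (𝕜 := ℂ), inner_sub_sub_self, h3, h2, h4,
    LinearIsometry.inner_map_map]
  ring

theorem fromTensor_connect {t r s : ℝ≥0} (h : t + r = s) (x : T.Tensor t) :
    D.fromTensor s (CovariantRep.connect hT h x) = D.fromTensor t x := by
  have : (D.fromTensor s).toContinuousLinearMap ∘L
      (CovariantRep.connect hT h).toContinuousLinearMap =
      (D.fromTensor t).toContinuousLinearMap :=
    tensor_ext T.rep fun ζ k => by simp [D.fromTensor_create, D.fromTensor_tilde_adjoint]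
  exact congrArg (fun S => S x) this

variable {hT} {K : Type*} [NormedAddCommGroup K] [InnerProductSpace ℂ K] [CompleteSpace K]
  (L : CovariantRep.LimitSpace hT K)

/-- A minimal isometric dilation is unitarily equivalent to the one on the inductive limit. -/
theorem exists_unitary : ∃ W : K ≃ₗᵢ[ℂ] K',
    (∀ t (ξ : E t) (x : K'), W (L.V t ξ (W.symm x)) = V'.T t ξ x) ∧
      ∀ h : H, W (L.embed h) = u₀' h := by
  obtain ⟨F, hF⟩ := L.exists_extension (fun t => (D.fromTensor t).toContinuousLinearMap) 1
    (fun t x => by simp) (fun h x => D.fromTensor_connect hT h x)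
  change ∀ t x, F (L.ι t x) = D.fromTensor t x at hF
  have hiso (x : K) : ‖F x‖ = ‖x‖ := by
    refine congrFun (Continuous.ext_on L.dense (f := fun x => ‖F x‖) (g := fun x => ‖x‖)
      (by fun_prop) (by fun_prop) ?_) x
    rintro _ ⟨_, ⟨t, rfl⟩, y, rfl⟩
    simp [hF]
  let W₀ : K →ₗᵢ[ℂ] K' := ⟨F.toLinearMap, hiso⟩
  have hW (x : K) : W₀ x = F x := rfl
  have hV {t : ℝ≥0} (ξ : E t) (x : K) : V'.T t ξ (F x) = F (L.V t ξ x) := by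
    have : V'.T t ξ ∘L F = F ∘L L.V t ξ := L.ext fun s x => by
      simp only [ContinuousLinearMap.comp_apply, hF, L.V_ι rfl, D.fromTensor_create]
    exact congrArg (fun S => S x) this
  have hu (h : H) : F (L.embed h) = u₀' h := by
    rw [L.embed_eq 0, hF, D.fromTensor_tilde_adjoint]
  have hclosed : IsClosed (W₀.toLinearMap.range : Set K') :=
    W₀.isometry.isClosedEmbedding.isClosed_range
  -- On the total set of vectors `V_t(η) y` this is `V'_t(ξ)⋆ V'_t(η) F y = V'_0(⟨ξ, η⟩) F y`, which
  -- is in the range of `F`.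
  have hadj {t : ℝ≥0} (ξ : E t) (x : K) : (V'.T t ξ).adjoint (F x) ∈ W₀.toLinearMap.range := by
    have h1 : (⊤ : Submodule ℂ K) ≤
        W₀.toLinearMap.range.comap ((V'.T t ξ).adjoint ∘L F).toLinearMap := by
      rw [← L.topologicalClosure_span_V t]
      refine Submodule.topologicalClosure_minimal _ (Submodule.span_le.mpr ?_)
        (hclosed.preimage ((V'.T t ξ).adjoint ∘L F).continuous)
      rintro _ ⟨⟨η, y⟩, rfl⟩
      refine ⟨L.V 0 (P.unit (ip N ξ η)) y, ?_⟩
      change F (L.V 0 (P.unit (ip N ξ η)) y) = (V'.T t ξ).adjoint (F (L.V t η y))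
      rw [← hV, ← hV, V'.T_unit, ← D.isometric]
      rfl
    exact h1 (Submodule.mem_top (x := x))
  have htop := D.minimal W₀.toLinearMap.range hclosed
    (by rintro _ ⟨h, rfl⟩; exact ⟨L.embed h, hu h⟩)
    (by
      rintro t ξ _ ⟨x, rfl⟩
      exact ⟨⟨L.V t ξ x, (hV ξ x).symm⟩, hadj ξ x⟩)
  let W := LinearIsometryEquiv.ofSurjective W₀ (LinearMap.range_eq_top.mp htop)
  have hWF (x : K) : W x = F x := rfl
  refine ⟨W, fun t ξ x => ?_, fun h => hu h⟩
  rw [hWF, ← hV, ← hWF, W.apply_symm_apply]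

end IsMinimalIsometricDilation

end ProductSystems

end


theorem theorem2p6
    {H₀ : Type w} [NormedAddCommGroup H₀] [InnerProductSpace ℂ H₀] [CompleteSpace H₀]
    (N : VonNeumannAlgebra H₀)
    (E : ℝ≥0 → Type u) [∀ t, NormedAddCommGroup (E t)] [∀ t, NormedSpace ℂ (E t)]
    [∀ t, CompleteSpace (E t)] [∀ t, Module (↥N)ᵐᵒᵖ (E t)] [∀ t, WStarCorrespondence N (E t)]
    (P : DiscreteProductSystem N E)
    {H : Type v} [NormedAddCommGroup H] [InnerProductSpace ℂ H] [CompleteSpace H]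
    (T : CovariantRep P H) (hT : T.IsFullyCoisometric) :
    ∃ (K : Type (max u v)) (_ : NormedAddCommGroup K) (_ : InnerProductSpace ℂ K)
      (_ : CompleteSpace K) (u₀ : H →ₗᵢ[ℂ] K) (V : CovariantRep P K),
      IsMinimalIsometricDilation T V u₀ ∧
      ∀ (K' : Type z) [NormedAddCommGroup K'] [InnerProductSpace ℂ K'] [CompleteSpace K']
        (u₀' : H →ₗᵢ[ℂ] K') (V' : CovariantRep P K'),
        IsMinimalIsometricDilation T V' u₀' →
        ∃ W : K ≃ₗᵢ[ℂ] K',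
          (∀ t (ξ : E t) (x : K'), W (V.T t ξ (W.symm x)) = V'.T t ξ x) ∧
          ∀ h : H, W (u₀ h) = u₀' h := by
  obtain ⟨K, _, _, _, ⟨L⟩⟩ := CovariantRep.exists_limitSpace hT
  exact ⟨K, inferInstance, inferInstance, inferInstance, L.embed, L.covariantRep,
    L.isMinimalIsometricDilation, fun K' _ _ _ u₀' V' D => D.exists_unitary L⟩
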